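/- **Setting.** For $u\in L^1(\mathbb R)$ let $u^+=\max\{0,u\}$, $u^-=\max\{0,-u\}$. For a probability density $u$ put $F_u(x)=\int_{-\infty}^x u$, $F_u^\dagger(y)=\inf\{x: F_u(x)>y\}$. Fix a reference $s_0\ge 0$, $\int s_0=1$. For $u\ge 0$ in $L^1$ put $u^\star=F^\dagger_{u/\|u\|_1}\circ F_{s_0}$ if $\|u\|_1\neq0$ and $u^\star=0$ otherwise. The signed cumulative distribution transform (SCDT) of $s\in L^1(\mathbb R)$ is $\hat s=((s^+)^\star,\|s^+\|_1,(s^-)^\star,\|s^-\|_1)$; write $\hat s^\pm=(s^\pm)^\star$. The norm of $(L^2(s_0(x)dx)\times\mathbb R)^2$ is denoted $\|\cdot\|$, and that of $L^2(s_0(x)dx)$ by $\|\cdot\|_{s_0}$. For $g:\mathbb R\to\mathbb R$, $g\circ\hat s$ is obtained from $\hat s$ by replacing $\hat s^\pm$ with $g\circ\hat s^\pm$, except that the component $0$ of a trivial part ($\|s^\pm\|_1=0$) is left unchanged. Let $$D_S^2(r,s)=J(r,s)+\delta(r,s),\qquad J(r,s)=\sum_{\pm}d_{W^2}^2\Big(\tfrac{r^\pm}{\|r^\pm\|_1},\tfrac{s^\pm}{\|s^\pm\|_1}\Big),\qquad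 \delta(r,s)=\sum_\pm\big|\|r^\pm\|_1-\|s^\pm\|_1\big|^2,$$ where $d_{W^2}$ is the quadratic Wasserstein distance, defined by couplings, and a normalized trivial part is read as the unit mass at $0$; $D_S$ and $J$ take values in $[0,\infty]$. A function $g$ is a *warp* on an interval $I\subseteq\mathbb R$ if it is continuous and strictly increasing on $I$ and its inverse $f:g(I)\to I$ is absolutely continuous on every compact subinterval of $g(I)$. For $r$ vanishing a.e. outside $I$ put $r_f=f'\cdot(r\circ f)$ on $g(I)$ and $r_f=0$ elsewhere. (For $I=\mathbb R$ and $g$ onto, $r_f=f'\cdot(r\circ f)$ with $f=g^{-1}$ on all of $\mathbb R$.) **Theorem.** Let $r,s\in L^1(\mathbb R)$. 1. *(Distance in transform space.)* If $g$ is a warp on $I$ and $r=0$ a.e. outside $I$, then $r_f\in L^1(\mathbb R)$; $\hat r_f=g\circ\hat r$ (function components $s_0\,dx$-a.e., $\|r_f^\pm\|_1=\|r^\pm\|_1$); $$D_S(r_f,s)=\|\hat r_f-\hat s\|=\|g\circ\hat r-\hat s\|,$$ and $J(r_f,s)$ is the sum of the two squared $L^2(s_0dx)$-distances of the function components of $g\circ\hat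 r$ and $\hat s$. If $x^2r_f,\ x^2s\in L^1$, then $D_S(r_f,s)<\infty$. 2. *(Polynomials.)* A polynomial that is strictly increasing on an interval $I$ is a warp on $I$. 3. *(Linear models.)* Let $g_p=\sum_{k=1}^m p_k\varphi_k$, $p\in\mathbb R^m$, with $\varphi_k$ Borel and $r\varphi_k^2\in L^1$ for all $k$, and let $x^2s\in L^1$. Let $X:\mathbb R^m\to L^2(s_0dx)^2$, $Xp=\sum_kp_k\Phi_k$, where $\Phi_k$ is the pair of function components of $\varphi_k\circ\hat r$, and let $\mathcal C(p)=\|Xp-(\hat s^+,\hat s^-)\|^2_{L^2(s_0dx)^2}$, the cost $\|g_p\circ\hat r-\hat s\|^2$ without mass terms. Then $D_S^2(r_{f_p},s)=\mathcal C(p)+\delta(r,s)$ whenever $g_p$ is a warp on some $I$ outside which $r=0$ a.e. ($f_p$ being the inverse of $g_p$ on $I$); $\mathcal C(p)=p^TX^TXp-2p^TX^T\hat s+\mathcal C(0)$ for all $p\in\mathbb R^m$ and $\mathcal C$ is convex. If $\Phi_1,\dots,\Phi_m$ are linearly independent, then $X^TX$ is invertible, $\tilde p=(X^TX)^{-1}X^T\hat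 s$ is the unique global minimizer of $\mathcal C$ over $\mathbb R^m$, and, if $g_{\tilde p}$ is a warp on an $I$ outside which $r=0$ a.e., then $D_S(r_{f_{\tilde p}},s)<D_S(r_{f_q},s)$ for every $q\ne\tilde p$ such that $g_q$ is a warp on $I$. 4. *(Discrete problem.)* For any functions $\varphi_1,\dots,\varphi_m$ on $\mathbb R$ and vectors $\hat{\mathbf r}^+,\hat{\mathbf s}^+\in\mathbb R^N$, $\hat{\mathbf r}^-,\hat{\mathbf s}^-\in\mathbb R^M$ let $X^\pm=(\varphi_k(\hat{\mathbf r}^\pm_i))_{i,k}$, $X=\begin{bmatrix}X^+\\X^-\end{bmatrix}$, $\hat{\mathbf s}=\begin{bmatrix}\hat{\mathbf s}^+\\\hat{\mathbf s}^-\end{bmatrix}$. The cost $$\|X^+p-\hat{\mathbf s}^+\|^2+\|X^-p-\hat{\mathbf s}^-\|^2=\|Xp-\hat{\mathbf s}\|^2=\sum_\pm\sum_i|g_p(\hat{\mathbf r}^\pm_i)-\hat{\mathbf s}^\pm_i|^2$$ is convex in $p\in\mathbb R^m$. If the columns of $X$ are linearly independent, then $X^TX$ is invertible and $\tilde p=(X^TX)^{-1}X^T\hat{\mathbf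 s}$ is its unique global minimizer. If $\|r^\pm\|_1\ne0$ and the vectors are the samples of $\hat r^\pm,\hat s^\pm$ at nodes $t_1,\dots,t_N$, the cost is $\sum_\pm\sum_i|g_p(\hat r^\pm(t_i))-\hat s^\pm(t_i)|^2$, the discretization of $\|g_p\circ\hat r-\hat s\|^2$ without mass terms. 5. *(Vandermonde case.)* For $g_p(t)=\sum_{k=0}^np_kt^k$ the columns of $X$ are linearly independent if and only if the entries of $\hat{\mathbf r}^+$ and $\hat{\mathbf r}^-$ together take at least $n+1$ distinct values. 6. *(Instances.)* Let $\|r^+\|_1,\|r^-\|_1\neq0$. For $g(t)=\omega t+\tau$, $\omega>0$, on $I=\mathbb R$: $D_S^2(r_f,s)=\sum_\pm\|\omega\hat r^\pm+\tau-\hat s^\pm\|_{s_0}^2+\delta(r,s)$. For $g(t)=\kappa t^2+\tau$, $\kappa>0$, on $I=[0,\infty)$, with $r=0$ a.e. on $(-\infty,0)$: $D_S^2(r_f,s)=\sum_\pm\|\kappa(\hat r^\pm)^2+\tau-\hat s^\pm\|_{s_0}^2+\delta(r,s)$. For all vectors as in 4 (with no condition on $r$), if the columns of $X=\begin{bmatrix}\hat{\mathbf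 r}^+&\mathbf 1\\\hat{\mathbf r}^-&\mathbf 1\end{bmatrix}$, respectively $X=\begin{bmatrix}(\hat{\mathbf r}^+)^2&\mathbf 1\\(\hat{\mathbf r}^-)^2&\mathbf 1\end{bmatrix}$ (entrywise squares), are linearly independent, then $(X^TX)^{-1}X^T\hat{\mathbf s}$ is the unique minimizer over $[\omega,\tau]^T\in\mathbb R^2$ of $\sum_\pm\sum_i|\omega\hat{\mathbf r}^\pm_i+\tau-\hat{\mathbf s}^\pm_i|^2$, respectively over $[\kappa,\tau]^T\in\mathbb R^2$ of $\sum_\pm\sum_i|\kappa(\hat{\mathbf r}^\pm_i)^2+\tau-\hat{\mathbf s}^\pm_i|^2$. -/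

import Mathlib

open MeasureTheory Set

noncomputable section

namespace SignalSCDT

/-! ### Signals, their parts, and the Wasserstein-type distance -/

/-- Positive part of a signal. -/
def positivePart (s : ℝ → ℝ) : ℝ → ℝ := fun x => max 0 (s x)

/-- Negative part of a signal (a non-negative function). -/
def negativePart (s : ℝ → ℝ) : ℝ → ℝ := fun x => max 0 (-s x)

/-- The `L¹` norm of a signal. -/
def l1Norm (u : ℝ → ℝ) : ℝ := ∫ x, |u x|

/-- `u / ‖u‖₁`. -/
def normalize (u : ℝ → ℝ) : ℝ → ℝ := fun x => u x / l1Norm u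

/-- The probability measure with density `u / ‖u‖₁`, for a non-negative `u ∈ L¹(ℝ)`.  If `u` is
trivial (zero almost everywhere), it is the unit mass at the origin; this is the convention that
corresponds to the value `0` of the transform of a trivial part. -/
def normalizedMeasure (u : ℝ → ℝ) : Measure ℝ :=
  open Classical in
  if l1Norm u = 0 then Measure.dirac 0
  else volume.withDensity (fun x => ENNReal.ofReal (normalize u x))

/-- The squared quadratic Wasserstein distance of two measures on the line: the infimum of the
transport cost over all couplings. -/
def wassersteinSq (μ ν : Measure ℝ) : ENNReal :=
  ⨅ π ∈ {π : Measure (ℝ × ℝ) | π.map Prod.fst = μ ∧ π.map Prod.snd = ν},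
    ∫⁻ z, ENNReal.ofReal ((z.1 - z.2) ^ 2) ∂π

/-- The Wasserstein part of the distance: the functional without the terms that compare masses. -/
def wassersteinFunctional (r s : ℝ → ℝ) : ENNReal :=
  wassersteinSq (normalizedMeasure (positivePart r)) (normalizedMeasure (positivePart s)) +
    wassersteinSq (normalizedMeasure (negativePart r)) (normalizedMeasure (negativePart s))

/-- The terms of the squared distance that compare the masses of the parts. -/
def massGap (r s : ℝ → ℝ) : ℝ :=
  |l1Norm (positivePart r) - l1Norm (positivePart s)| ^ 2 + |l1Norm (negativePart r) - l1Norm (negativePart s)| ^ 2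

/-- The Wasserstein-type distance `D_S` of two signed signals (with values in `[0, ∞]`). -/
def distS (r s : ℝ → ℝ) : ENNReal :=
  (wassersteinFunctional r s + ENNReal.ofReal (massGap r s)) ^ (1 / 2 : ℝ)

/-! ### The signed cumulative distribution transform -/

/-- A reference signal: non-negative, integrable, of total mass one. -/
structure IsReference (s₀ : ℝ → ℝ) : Prop where
  nonneg : ∀ x, 0 ≤ s₀ x
  integrable : Integrable s₀
  integral_eq_one : ∫ x, s₀ x = 1

/-- The measure `s₀(x) dx`. -/
def refMeasure (s₀ : ℝ → ℝ) : Measure ℝ :=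
  volume.withDensity (fun x => ENNReal.ofReal (s₀ x))

/-- The cumulation of a signal. -/
def cumulation (s : ℝ → ℝ) : ℝ → ℝ := fun x => ∫ t in Iic x, s t

/-- The generalized inverse of a function.  For the cumulation of a probability density the
infimum is taken over a non-empty set that is bounded below whenever `0 < y < 1`. -/
def genInverse (F : ℝ → ℝ) : ℝ → ℝ := fun y => sInf {x | y < F x}

/-- The cumulative distribution transform of a probability density `s` with respect to `s₀`. -/
def cdt (s₀ s : ℝ → ℝ) : ℝ → ℝ := genInverse (cumulation s) ∘ cumulation s₀

/-- The transform of the normalization of a non-negative `u`; zero if `u` is trivial. -/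
def cdtOrZero (s₀ u : ℝ → ℝ) : ℝ → ℝ :=
  open Classical in
  if l1Norm u = 0 then 0 else cdt s₀ (normalize u)

/-- Elements of the transform space: the transform of the positive part, its mass, the transform
of the negative part, its mass. -/
structure Transform where
  pos : ℝ → ℝ
  posMass : ℝ
  neg : ℝ → ℝ
  negMass : ℝ

/-- The signed cumulative distribution transform of `s` with respect to `s₀`. -/
def scdt (s₀ s : ℝ → ℝ) : Transform where
  pos := cdtOrZero s₀ (positivePart s)
  posMass := l1Norm (positivePart s)
  neg := cdtOrZero s₀ (negativePart s)
  negMass := l1Norm (negativePart s)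

/-- The part of `‖u - v‖²` that does not involve the masses, namely
`‖u.pos - v.pos‖² + ‖u.neg - v.neg‖²` with the norm of `L²(s₀(x) dx)`. -/
def shapeDistSq (s₀ : ℝ → ℝ) (u v : Transform) : ENNReal :=
  eLpNorm (u.pos - v.pos) 2 (refMeasure s₀) ^ 2 + eLpNorm (u.neg - v.neg) 2 (refMeasure s₀) ^ 2

/-- `‖u - v‖` in `(L²(s₀(x) dx) × ℝ)²`. -/
def transformDist (s₀ : ℝ → ℝ) (u v : Transform) : ENNReal :=
  (shapeDistSq s₀ u v + ENNReal.ofReal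
    (|u.posMass - v.posMass| ^ 2 + |u.negMass - v.negMass| ^ 2)) ^ (1 / 2 : ℝ)

/-- `g ∘ u`: composition of the two function components of `u` with `g`, where the zero component
of a trivial part (one of mass zero) is left as it is. -/
def comp (g : ℝ → ℝ) (u : Transform) : Transform :=
  open Classical in
  { pos := if u.posMass = 0 then 0 else g ∘ u.pos
    posMass := u.posMass
    neg := if u.negMass = 0 then 0 else g ∘ u.neg
    negMass := u.negMass }

/-! ### Warped signals -/

/-- `g` is an admissible time warp on the interval `I`: continuous and strictly increasing on `I`,
with an inverse `g(I) → I` that is locally absolutely continuous.  On `I = univ` this comprises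
the increasing bijections of the line with a locally absolutely continuous inverse. -/
structure IsWarp (I : Set ℝ) (g : ℝ → ℝ) : Prop where
  ordConnected : I.OrdConnected
  strictMonoOn : StrictMonoOn g I
  continuousOn : ContinuousOn g I
  inverse_ac : ∀ a b, a ≤ b → Icc a b ⊆ g '' I →
    AbsolutelyContinuousOnInterval (Function.invFunOn g I) a b

/-- The warped signal `r_f = f' · (r ∘ f)`, where `f : g(I) → I` is the inverse of `g` on `I`;
it vanishes outside `g(I)`. -/
def warpedSignal (I : Set ℝ) (g r : ℝ → ℝ) : ℝ → ℝ :=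
  (g '' I).indicator
    (fun t => deriv (Function.invFunOn g I) t * r (Function.invFunOn g I t))

/-- For an increasing bijection of the whole line, the warped signal is literally
`f' · (r ∘ f)` with `f` the inverse. -/
theorem warpedSignal_orderIso (g : ℝ ≃o ℝ) (r : ℝ → ℝ) :
    warpedSignal univ g r = fun t => deriv g.symm t * r (g.symm t) := by
  have h : Function.invFunOn g univ = g.symm := by
    funext t
    have ht : t ∈ (g : ℝ → ℝ) '' univ := ⟨g.symm t, mem_univ _, by simp⟩
    have := Function.invFunOn_eq ht
    apply g.injective
    rw [this, OrderIso.apply_symm_apply]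
  have hr : (g : ℝ → ℝ) '' univ = univ := by
    rw [image_univ]; exact g.surjective.range_eq
  unfold warpedSignal
  rw [h, hr, indicator_univ]

/-! ### Models that are linear in their parameters -/

/-- `g_p = ∑ p_k φ_k`. -/
def linModel {m : ℕ} (φ : Fin m → ℝ → ℝ) (p : Fin m → ℝ) : ℝ → ℝ := fun t => ∑ k, p k * φ k t

/-- The monomials `1, t, …, t ^ n`. -/
def monomials (n : ℕ) : Fin (n + 1) → ℝ → ℝ := fun k t => t ^ (k : ℕ)

/-- The model functions of `g(t) = ω t + τ`. -/
def linearBasis : Fin 2 → ℝ → ℝ := ![fun t => t, fun _ => 1]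

/-- The model functions of `g(t) = κ t ^ 2 + τ`. -/
def quadraticBasis : Fin 2 → ℝ → ℝ := ![fun t => t ^ 2, fun _ => 1]

/-- The real-valued cost `‖g_p ∘ r̂ - ŝ‖²` in `L²(s₀(x) dx)²` (masses are left out). -/
def fitCost (s₀ r s : ℝ → ℝ) {m : ℕ} (φ : Fin m → ℝ → ℝ) (p : Fin m → ℝ) : ℝ :=
  (∫ x, ((comp (linModel φ p) (scdt s₀ r)).pos x - (scdt s₀ s).pos x) ^ 2 ∂refMeasure s₀) +
    ∫ x, ((comp (linModel φ p) (scdt s₀ r)).neg x - (scdt s₀ s).neg x) ^ 2 ∂refMeasure s₀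

/-- The matrix `XᵀX` of the operator `X : ℝᵐ → L²(s₀(x) dx)²`, `X p = ∑ p_k (φ_k ∘ r̂)`. -/
def gram (s₀ r : ℝ → ℝ) {m : ℕ} (φ : Fin m → ℝ → ℝ) : Matrix (Fin m) (Fin m) ℝ :=
  Matrix.of fun k l =>
    (∫ x, (comp (φ k) (scdt s₀ r)).pos x * (comp (φ l) (scdt s₀ r)).pos x ∂refMeasure s₀) +
      ∫ x, (comp (φ k) (scdt s₀ r)).neg x * (comp (φ l) (scdt s₀ r)).neg x ∂refMeasure s₀

/-- The vector `Xᵀŝ` for the same operator. -/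
def gramRhs (s₀ r s : ℝ → ℝ) {m : ℕ} (φ : Fin m → ℝ → ℝ) : Fin m → ℝ := fun k =>
  (∫ x, (comp (φ k) (scdt s₀ r)).pos x * (scdt s₀ s).pos x ∂refMeasure s₀) +
    ∫ x, (comp (φ k) (scdt s₀ r)).neg x * (scdt s₀ s).neg x ∂refMeasure s₀

/-- The columns `φ_k ∘ r̂` of the operator `X` are linearly independent in `L²(s₀(x) dx)²`. -/
def IndependentColumns (s₀ r : ℝ → ℝ) {m : ℕ} (φ : Fin m → ℝ → ℝ) : Prop :=
  ∀ p : Fin m → ℝ,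
    (∀ᵐ x ∂refMeasure s₀, ∑ k, p k * (comp (φ k) (scdt s₀ r)).pos x = 0) →
    (∀ᵐ x ∂refMeasure s₀, ∑ k, p k * (comp (φ k) (scdt s₀ r)).neg x = 0) → p = 0

/-- The block `X^±`, with entries `φ_k (u_i)`; for the monomials it is the Vandermonde-type matrix
`[1, u, u², …, uⁿ]`. -/
def modelMatrix {m N : ℕ} (φ : Fin m → ℝ → ℝ) (u : Fin N → ℝ) : Matrix (Fin N) (Fin m) ℝ :=
  Matrix.of fun i k => φ k (u i)

/-- The matrix with the blocks `X⁺` and `X⁻` on top of each other. -/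
def designMatrix {m N M : ℕ} (φ : Fin m → ℝ → ℝ) (rp : Fin N → ℝ) (rm : Fin M → ℝ) :
    Matrix (Fin N ⊕ Fin M) (Fin m) ℝ :=
  Matrix.fromRows (modelMatrix φ rp) (modelMatrix φ rm)

/-- The discrete cost `‖X⁺ p - ŝ⁺‖² + ‖X⁻ p - ŝ⁻‖²`. -/
def discreteCost {m N M : ℕ} (φ : Fin m → ℝ → ℝ) (rp sp : Fin N → ℝ) (rm sm : Fin M → ℝ)
    (p : Fin m → ℝ) : ℝ :=
  (∑ i, ((modelMatrix φ rp).mulVec p i - sp i) ^ 2) +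
    ∑ i, ((modelMatrix φ rm).mulVec p i - sm i) ^ 2

/-- The closed form `(XᵀX)⁻¹ Xᵀ y`. -/
def leastSquaresSolution {ι : Type} [Fintype ι] {m : ℕ} (X : Matrix ι (Fin m) ℝ) (y : ι → ℝ) :
    Fin m → ℝ :=
  ((X.transpose * X)⁻¹).mulVec (X.transpose.mulVec y)

/-- The discretization of `‖u - v‖²` at the nodes `t` (masses are left out). -/
def sampledDistSq {N : ℕ} (t : Fin N → ℝ) (u v : Transform) : ℝ :=
  (∑ i, (u.pos (t i) - v.pos (t i)) ^ 2) + ∑ i, (u.neg (t i) - v.neg (t i)) ^ 2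

end SignalSCDT

end

/-!
The proof rests on one fact about the line: two functions that increase together on a set of full
measure provide an optimal coupling of their image measures for the quadratic cost
(`wassersteinSq_map_map`). Writing `(x - y) ^ 2` as the area of a square and exchanging
integrals turns the cost of a coupling into an integral of masses of quadrants
`{X ≤ a, b < Y}`. Each of them is at least `P (X ≤ a) - P (Y ≤ b)`, and this bound is attained when
the sublevel sets are nested. No moment is assumed. Since the diagonal coupling costs nothing,
increasing maps with the same image measure agree almost everywhere
(`ae_eq_of_map_eq_of_monotoneOn`).

The transform of a part of a signal is increasing where the reference has a cumulation strictly
between `0` and `1`, and it pushes `s₀(x) dx` forward to the normalized part (`map_cdtOrZero`). Hence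
the Wasserstein part of `D_S` is the distance of the transforms. Warping a signal amounts to pushing
its parts forward by `g` (`IsWarp.refMeasure_warpedSignal`): this is the change of variables for the
inverse `f`, where absolute continuity guarantees, through the fundamental theorem of calculus, that
`f` loses no mass at the points where it is not differentiable. So the transform of the warped signal
and `g ∘ r̂` are increasing maps with the same image measure, and they coincide.

An increasing polynomial has an inverse that is differentiable off finitely many points, so the
inverse is the integral of its derivative and absolutely continuous. The costs of the linear models
are quadratic polynomials in the parameters with a positive semidefinite matrix, definite when the
columns are independent; completing the square gives the minimizer (`lt_of_quadratic_pos`), both in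
transform space and for samples. For monomials, dependence of the columns means that a nonzero
polynomial of degree at most `n` vanishes at all nodes.
-/

namespace SignalSCDT

/-! ### Optimal transport on the line by monotone maps -/

/-- The square of a difference as an area: exactly one of the two squares
`[x, y)²`, `[y, x)²` is non-empty, and its area is `(x - y)²`. -/
theorem ofReal_sub_sq_eq_volume (x y : ℝ) :
    ENNReal.ofReal ((x - y) ^ 2)
      = volume (Ico x y ×ˢ Ico x y) + volume (Ico y x ×ˢ Ico y x) := by
  rw [Measure.volume_eq_prod, Measure.prod_prod, Measure.prod_prod, Real.volume_Ico,
    Real.volume_Ico]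
  rcases le_total x y with h | h
  · rw [ENNReal.ofReal_of_nonpos (sub_nonpos.2 h), mul_zero, add_zero,
      ← ENNReal.ofReal_mul (sub_nonneg.2 h)]
    congr 1; ring
  · rw [ENNReal.ofReal_of_nonpos (sub_nonpos.2 h), mul_zero, zero_add,
      ← ENNReal.ofReal_mul (sub_nonneg.2 h)]
    congr 1; ring

theorem measurableSet_le_and_lt {α : Type*} [MeasurableSpace α] {f g h k : α → ℝ}
    (hf : Measurable f) (hg : Measurable g) (hh : Measurable h) (hk : Measurable k) :
    MeasurableSet {a | f a ≤ g a ∧ h a < k a} := by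
  rw [ofPred_and]
  exact (measurableSet_le hf hg).inter (measurableSet_lt hh hk)

/-- Layer-cake formula for the quadratic transport cost. -/
theorem lintegral_sub_sq_eq_lintegral_quadrants (π : Measure (ℝ × ℝ)) [SFinite π] :
    ∫⁻ z, ENNReal.ofReal ((z.1 - z.2) ^ 2) ∂π
      = ∫⁻ w : ℝ × ℝ, (π {z | z.1 ≤ min w.1 w.2 ∧ max w.1 w.2 < z.2}
          + π {z | z.2 ≤ min w.1 w.2 ∧ max w.1 w.2 < z.1}) := by
  have key : ∀ {p q : ℝ × ℝ → ℝ}, Measurable p → Measurable q →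
      ∫⁻ z, volume (Ico (p z) (q z) ×ˢ Ico (p z) (q z)) ∂π
        = ∫⁻ w : ℝ × ℝ, π {z | p z ≤ min w.1 w.2 ∧ max w.1 w.2 < q z} := by
    intro p q hp hq
    have hE : MeasurableSet {a : (ℝ × ℝ) × (ℝ × ℝ) |
        p a.1 ≤ min a.2.1 a.2.2 ∧ max a.2.1 a.2.2 < q a.1} :=
      measurableSet_le_and_lt (by fun_prop) (by fun_prop) (by fun_prop) (by fun_prop)
    have h1 := Measure.prod_apply (μ := π) (ν := (volume : Measure (ℝ × ℝ))) hE
    have h2 := Measure.prod_apply_symm (μ := π) (ν := (volume : Measure (ℝ × ℝ))) hE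
    rw [h1] at h2
    calc _ = _ := by
          refine lintegral_congr fun z => ?_
          congr 1
          ext w
          simp only [mem_prod, mem_Ico, mem_preimage, mem_ofPred_eq, le_min_iff, max_lt_iff]
          tauto
      _ = _ := h2
      _ = _ := rfl
  have hm : Measurable fun z : ℝ × ℝ => volume (Ico z.1 z.2 ×ˢ Ico z.1 z.2) := by
    simp only [Measure.volume_eq_prod, Measure.prod_prod, Real.volume_Ico]
    fun_prop
  have hm' : Measurable fun w : ℝ × ℝ => π {z | z.1 ≤ min w.1 w.2 ∧ max w.1 w.2 < z.2} := by
    have hE : MeasurableSet {a : (ℝ × ℝ) × (ℝ × ℝ) |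
        a.1.1 ≤ min a.2.1 a.2.2 ∧ max a.2.1 a.2.2 < a.1.2} :=
      measurableSet_le_and_lt (by fun_prop) (by fun_prop) (by fun_prop) (by fun_prop)
    exact measurable_measure_prodMk_right hE
  simp only [ofReal_sub_sq_eq_volume]
  rw [lintegral_add_left hm, lintegral_add_left hm', key measurable_fst measurable_snd,
    key measurable_snd measurable_fst]

/-- The mass that any coupling puts on a quadrant is bounded below by the difference of the
distribution functions of the marginals. -/
theorem measure_Iic_tsub_le {Ω : Type*} [MeasurableSpace Ω] (P : Measure Ω) (X Y : Ω → ℝ)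
    (a b : ℝ) : P {ω | X ω ≤ a} - P {ω | Y ω ≤ b} ≤ P {ω | X ω ≤ a ∧ b < Y ω} := by
  refine tsub_le_iff_right.2 ((measure_mono fun ω hω => ?_).trans (measure_union_le _ _))
  rcases lt_or_ge b (Y ω) with h | h
  · exact Or.inl ⟨hω, h⟩
  · exact Or.inr h

/-- For two functions that increase together, sublevel sets are nested, so the lower bound
`measure_Iic_tsub_le` is attained. -/
theorem measure_le_tsub_of_monotoneOn {ρ : Measure ℝ} [IsFiniteMeasure ρ] {S : Set ℝ}
    (hS : ρ Sᶜ = 0) {T U : ℝ → ℝ} (hT : MonotoneOn T S) (hU : MonotoneOn U S)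
    (hUm : AEMeasurable U ρ) (a b : ℝ) :
    ρ {x | T x ≤ a ∧ b < U x} ≤ ρ {x | T x ≤ a} - ρ {x | U x ≤ b} := by
  by_cases h : ∃ x ∈ S, T x ≤ a ∧ b < U x
  · obtain ⟨x, hxS, hxT, hxU⟩ := h
    -- here `{U ≤ b}` lies in `{T ≤ a}` up to a null set
    have hn : NullMeasurableSet {x | U x ≤ b} ρ := nullMeasurableSet_le hUm aemeasurable_const
    have hsub : ({x | U x ≤ b} : Set ℝ) ≤ᵐ[ρ] {x | T x ≤ a} := by
      have : ∀ᵐ y ∂ρ, y ∈ S := hS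
      filter_upwards [this] with y hy hyU
      have hyx : y ≤ x := by
        by_contra hlt
        exact absurd (hU hxS hy (not_le.1 hlt).le) (not_le.2 (lt_of_le_of_lt hyU hxU))
      exact (hT hy hxS hyx).trans hxT
    have hset : {x | T x ≤ a ∧ b < U x} = {x | T x ≤ a} \ {x | U x ≤ b} := by
      ext y; simp
    rw [hset]
    refine ENNReal.le_sub_of_add_le_right (measure_ne_top _ _) ?_
    rw [← measure_union₀ hn
      (Set.disjoint_sdiff_left.aedisjoint)]
    refine measure_mono_ae ?_
    filter_upwards [hsub] with y hy h
    rcases h with h | h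
    · exact h.1
    · exact hy h
  · push Not at h
    have : ρ {x | T x ≤ a ∧ b < U x} = 0 := by
      refine measure_mono_null ?_ hS
      intro x hx hxS
      exact absurd hx.2 (not_lt.2 (h x hxS hx.1))
    rw [this]; exact zero_le

/-- Two functions that increase together provide an optimal coupling: this is the one-dimensional
theory of quadratic optimal transport, with no moment assumption (both sides may be infinite). -/
theorem wassersteinSq_map_map {ρ : Measure ℝ} [IsFiniteMeasure ρ] {S : Set ℝ}
    (hS : ρ Sᶜ = 0) {T U : ℝ → ℝ} (hT : MonotoneOn T S) (hU : MonotoneOn U S)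
    (hTm : AEMeasurable T ρ) (hUm : AEMeasurable U ρ) :
    wassersteinSq (ρ.map T) (ρ.map U) = ∫⁻ x, ENNReal.ofReal ((T x - U x) ^ 2) ∂ρ := by
  have hTU : AEMeasurable (fun x => (T x, U x)) ρ := hTm.prodMk hUm
  have hcost : ∫⁻ x, ENNReal.ofReal ((T x - U x) ^ 2) ∂ρ
      = ∫⁻ z, ENNReal.ofReal ((z.1 - z.2) ^ 2) ∂(ρ.map fun x => (T x, U x)) := by
    rw [lintegral_map' (by fun_prop) hTU]
  unfold wassersteinSq
  refine le_antisymm ?_ ?_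
  · rw [hcost]
    refine iInf₂_le _ ⟨?_, ?_⟩
    · rw [AEMeasurable.map_map_of_aemeasurable measurable_fst.aemeasurable hTU]; rfl
    · rw [AEMeasurable.map_map_of_aemeasurable measurable_snd.aemeasurable hTU]; rfl
  · refine le_iInf₂ fun π hπ => ?_
    obtain ⟨h1, h2⟩ := hπ
    have hfin : IsFiniteMeasure π := by
      refine ⟨?_⟩
      have := congrArg (fun μ => μ univ) h1
      simp only [Measure.map_apply measurable_fst MeasurableSet.univ, preimage_univ] at this
      rw [this]
      exact measure_lt_top _ _
    have hf : ∀ c, π {z | z.1 ≤ c} = ρ {x | T x ≤ c} := by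
      intro c
      have := congrArg (fun μ => μ (Iic c)) h1
      simp only [Measure.map_apply measurable_fst measurableSet_Iic,
        Measure.map_apply_of_aemeasurable hTm measurableSet_Iic] at this
      exact this
    have hs : ∀ c, π {z | z.2 ≤ c} = ρ {x | U x ≤ c} := by
      intro c
      have := congrArg (fun μ => μ (Iic c)) h2
      simp only [Measure.map_apply measurable_snd measurableSet_Iic,
        Measure.map_apply_of_aemeasurable hUm measurableSet_Iic] at this
      exact this
    rw [hcost, lintegral_sub_sq_eq_lintegral_quadrants, lintegral_sub_sq_eq_lintegral_quadrants]
    refine lintegral_mono fun w => add_le_add ?_ ?_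
    · rw [Measure.map_apply_of_aemeasurable hTU
        (measurableSet_le_and_lt (by fun_prop) (by fun_prop) (by fun_prop) (by fun_prop))]
      refine (measure_le_tsub_of_monotoneOn hS hT hU hUm _ _).trans ?_
      rw [← hf, ← hs]
      exact measure_Iic_tsub_le π Prod.fst Prod.snd _ _
    · rw [Measure.map_apply_of_aemeasurable hTU
        (measurableSet_le_and_lt (by fun_prop) (by fun_prop) (by fun_prop) (by fun_prop))]
      refine (measure_le_tsub_of_monotoneOn hS hU hT hTm _ _).trans ?_
      rw [← hf, ← hs]
      exact measure_Iic_tsub_le π Prod.snd Prod.fst _ _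

theorem wassersteinSq_self (μ : Measure ℝ) : wassersteinSq μ μ = 0 := by
  have hd : Measurable fun x : ℝ => (x, x) := by fun_prop
  refine le_antisymm ?_ (zero_le)
  refine iInf₂_le_of_le (μ.map fun x => (x, x)) ⟨?_, ?_⟩ ?_
  · rw [Measure.map_map measurable_fst hd]; exact Measure.map_id
  · rw [Measure.map_map measurable_snd hd]; exact Measure.map_id
  · rw [lintegral_map (by fun_prop) hd]; simp

/-- Uniqueness of monotone transport: the diagonal coupling costs nothing, so two monotone maps
with the same image measure have squared distance zero. -/
theorem ae_eq_of_map_eq_of_monotoneOn {ρ : Measure ℝ} [IsFiniteMeasure ρ] {S : Set ℝ}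
    (hS : ρ Sᶜ = 0) {T U : ℝ → ℝ} (hT : MonotoneOn T S) (hU : MonotoneOn U S)
    (hTm : AEMeasurable T ρ) (hUm : AEMeasurable U ρ) (h : ρ.map T = ρ.map U) : T =ᵐ[ρ] U := by
  have h0 := wassersteinSq_map_map hS hT hU hTm hUm
  rw [h, wassersteinSq_self, eq_comm, lintegral_eq_zero_iff' (by fun_prop)] at h0
  filter_upwards [h0] with x hx
  have : (T x - U x) ^ 2 ≤ 0 := ENNReal.ofReal_eq_zero.1 hx
  have := pow_eq_zero_iff (two_ne_zero) |>.1 (le_antisymm this (sq_nonneg _))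
  linarith

theorem eLpNorm_two_sq {μ : Measure ℝ} (f : ℝ → ℝ) :
    eLpNorm f 2 μ ^ 2 = ∫⁻ x, ENNReal.ofReal (f x ^ 2) ∂μ := by
  have := eLpNorm_nnreal_pow_eq_lintegral (f := f) (μ := μ) (p := 2) two_ne_zero
  simp only [NNReal.coe_ofNat, ENNReal.coe_ofNat, ENNReal.rpow_ofNat] at this
  rw [this]
  refine lintegral_congr fun x => ?_
  rw [← ofReal_norm, ← ENNReal.ofReal_pow (norm_nonneg _), Real.norm_eq_abs, sq_abs]

/-! ### The transform pushes the reference forward to the signal -/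

namespace IsReference

variable {u : ℝ → ℝ}

theorem isProbabilityMeasure (h : IsReference u) : IsProbabilityMeasure (refMeasure u) := by
  refine ⟨?_⟩
  rw [refMeasure, withDensity_apply _ MeasurableSet.univ, Measure.restrict_univ,
    ← ofReal_integral_eq_lintegral_ofReal h.integrable (.of_forall h.nonneg),
    h.integral_eq_one, ENNReal.ofReal_one]

theorem refMeasure_Iic (h : IsReference u) (x : ℝ) :
    refMeasure u (Iic x) = ENNReal.ofReal (cumulation u x) := by
  rw [refMeasure, withDensity_apply _ measurableSet_Iic, cumulation,
    ofReal_integral_eq_lintegral_ofReal h.integrable.integrableOn (.of_forall h.nonneg)]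

theorem refMeasure_Iio (h : IsReference u) (x : ℝ) :
    refMeasure u (Iio x) = ENNReal.ofReal (cumulation u x) := by
  rw [← h.refMeasure_Iic, refMeasure, withDensity_apply _ measurableSet_Iic,
    withDensity_apply _ measurableSet_Iio, setLIntegral_congr Iio_ae_eq_Iic]

theorem cumulation_nonneg (h : IsReference u) (x : ℝ) : 0 ≤ cumulation u x :=
  integral_nonneg fun t => h.nonneg t

theorem cumulation_eq_cdf (h : IsReference u) :
    cumulation u = ProbabilityTheory.cdf (refMeasure u) := by
  have := h.isProbabilityMeasure
  funext x
  rw [ProbabilityTheory.cdf_eq_real, measureReal_def, h.refMeasure_Iic,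
    ENNReal.toReal_ofReal (h.cumulation_nonneg x)]

theorem cumulation_mono (h : IsReference u) : Monotone (cumulation u) := by
  rw [h.cumulation_eq_cdf]; exact ProbabilityTheory.monotone_cdf _

theorem cumulation_le_one (h : IsReference u) (x : ℝ) : cumulation u x ≤ 1 := by
  rw [h.cumulation_eq_cdf]; exact ProbabilityTheory.cdf_le_one _ x

theorem cumulation_continuous (h : IsReference u) : Continuous (cumulation u) := by
  have heq : cumulation u = fun x => (∫ t in Iic (0 : ℝ), u t) + ∫ t in (0 : ℝ)..x, u t := by
    funext x
    rw [← intervalIntegral.integral_Iic_sub_Iic h.integrable.integrableOn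
      h.integrable.integrableOn]
    simp [cumulation]
  rw [heq]
  exact continuous_const.add
    (intervalIntegral.continuous_primitive (fun _ _ => h.integrable.intervalIntegrable) 0)

theorem exists_lt_cumulation (h : IsReference u) {c : ℝ} (hc : c < 1) :
    ∃ x, c < cumulation u x := by
  have ht := ProbabilityTheory.tendsto_cdf_atTop (refMeasure u)
  rw [← h.cumulation_eq_cdf] at ht
  exact (ht.eventually (lt_mem_nhds hc)).exists

theorem exists_cumulation_lt (h : IsReference u) {c : ℝ} (hc : 0 < c) :
    ∃ x, cumulation u x < c := by
  have ht := ProbabilityTheory.tendsto_cdf_atBot (refMeasure u)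
  rw [← h.cumulation_eq_cdf] at ht
  exact (ht.eventually (gt_mem_nhds hc)).exists

/-- Upper half of the statement that the cumulation is uniformly distributed on `[0, 1]`. -/
theorem refMeasure_cumulation_le (h : IsReference u) {c : ℝ} :
    refMeasure u {x | cumulation u x ≤ c} ≤ ENNReal.ofReal c := by
  have := h.isProbabilityMeasure
  rcases le_or_gt 1 c with hc | hc
  · exact prob_le_one.trans (by simpa using ENNReal.ofReal_le_ofReal hc)
  rcases eq_empty_or_nonempty {x | cumulation u x ≤ c} with he | hne
  · simp [he]
  obtain ⟨y, hy⟩ := h.exists_lt_cumulation hc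
  have hb : BddAbove {x | cumulation u x ≤ c} :=
    ⟨y, fun x hx => by
      by_contra hlt
      exact absurd (h.cumulation_mono (not_le.1 hlt).le) (not_le.2 (lt_of_le_of_lt hx hy))⟩
  have hcl : IsClosed {x | cumulation u x ≤ c} :=
    isClosed_le h.cumulation_continuous continuous_const
  calc refMeasure u {x | cumulation u x ≤ c}
      ≤ refMeasure u (Iic (sSup {x | cumulation u x ≤ c})) :=
        measure_mono fun x hx => le_csSup hb hx
    _ = _ := h.refMeasure_Iic _
    _ ≤ _ := ENNReal.ofReal_le_ofReal (hcl.csSup_mem hne hb)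

/-- Lower half of the statement that the cumulation is uniformly distributed on `[0, 1]`. -/
theorem le_refMeasure_cumulation_lt (h : IsReference u) {c : ℝ} (hc1 : c ≤ 1) :
    ENNReal.ofReal c ≤ refMeasure u {x | cumulation u x < c} := by
  have := h.isProbabilityMeasure
  rcases le_or_gt c 0 with hc | hc
  · simp [ENNReal.ofReal_of_nonpos hc]
  rcases eq_empty_or_nonempty {x | c ≤ cumulation u x} with he | hne
  · have : {x | cumulation u x < c} = univ := by
      refine eq_univ_of_forall fun x => ?_
      by_contra hx
      have hx' : c ≤ cumulation u x := not_lt.1 hx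
      exact (eq_empty_iff_forall_notMem.1 he) x hx'
    rw [this, measure_univ]
    simpa using ENNReal.ofReal_le_ofReal hc1
  obtain ⟨y, hy⟩ := h.exists_cumulation_lt hc
  have hb : BddBelow {x | c ≤ cumulation u x} :=
    ⟨y, fun x hx => by
      by_contra hlt
      exact absurd (h.cumulation_mono (not_le.1 hlt).le) (not_le.2 (lt_of_lt_of_le hy hx))⟩
  have hcl : IsClosed {x | c ≤ cumulation u x} :=
    isClosed_le continuous_const h.cumulation_continuous
  calc ENNReal.ofReal c
      ≤ ENNReal.ofReal (cumulation u (sInf {x | c ≤ cumulation u x})) :=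
        ENNReal.ofReal_le_ofReal (hcl.csInf_mem hne hb)
    _ = refMeasure u (Iio (sInf {x | c ≤ cumulation u x})) := (h.refMeasure_Iio _).symm
    _ ≤ _ := measure_mono fun x hx => by
        by_contra hlt
        exact absurd (csInf_le hb (not_lt.1 hlt : c ≤ cumulation u x)) (not_le.2 hx)

end IsReference

/-- The set on which the generalized inverse of a distribution function is evaluated at a
proper level, strictly between `0` and `1`; outside it the infimum may be a junk value. -/
def properSet (s₀ : ℝ → ℝ) : Set ℝ := {x | 0 < cumulation s₀ x ∧ cumulation s₀ x < 1}

section Transform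

variable {s₀ u v : ℝ → ℝ}

theorem measurableSet_properSet (h₀ : IsReference s₀) : MeasurableSet (properSet s₀) := by
  have hm := h₀.cumulation_continuous.measurable
  rw [properSet, ofPred_and]
  exact (measurableSet_lt measurable_const hm).inter (measurableSet_lt hm measurable_const)

theorem refMeasure_properSet_compl (h₀ : IsReference s₀) :
    refMeasure s₀ (properSet s₀)ᶜ = 0 := by
  have := h₀.isProbabilityMeasure
  have hm := h₀.cumulation_continuous.measurable
  have h1 : refMeasure s₀ {x | cumulation s₀ x ≤ 0} = 0 := by
    simpa using h₀.refMeasure_cumulation_le (c := 0)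
  have h2 : refMeasure s₀ {x | cumulation s₀ x < 1}ᶜ = 0 := by
    rw [prob_compl_eq_zero_iff (measurableSet_lt hm measurable_const)]
    exact le_antisymm prob_le_one (by simpa using h₀.le_refMeasure_cumulation_lt le_rfl)
  refine measure_mono_null ?_ (measure_union_null h1 h2)
  intro x hx
  by_contra hn
  rw [mem_union, not_or] at hn
  exact hx ⟨not_le.1 hn.1, not_not.1 hn.2⟩

theorem bddBelow_lt_cumulation (h : IsReference u) {y : ℝ} (hy : 0 < y) :
    BddBelow {x | y < cumulation u x} := by
  obtain ⟨z, hz⟩ := h.exists_cumulation_lt hy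
  refine ⟨z, fun x hx => ?_⟩
  by_contra hlt
  exact absurd (h.cumulation_mono (not_le.1 hlt).le) (not_le.2 (hz.trans hx))

theorem cdt_monotoneOn (h : IsReference u) (h₀ : IsReference s₀) :
    MonotoneOn (cdt s₀ u) (properSet s₀) := by
  intro x hx y hy hxy
  refine csInf_le_csInf (bddBelow_lt_cumulation h hx.1) (h.exists_lt_cumulation hy.2) ?_
  intro z hz
  exact lt_of_le_of_lt (h₀.cumulation_mono hxy) hz

theorem aemeasurable_of_monotoneOn_properSet (h₀ : IsReference s₀) {T : ℝ → ℝ}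
    (hT : MonotoneOn T (properSet s₀)) : AEMeasurable T (refMeasure s₀) := by
  have h := aemeasurable_restrict_of_monotoneOn (μ := refMeasure s₀)
    (measurableSet_properSet h₀) hT
  rwa [Measure.restrict_eq_self_of_ae_mem] at h
  exact refMeasure_properSet_compl h₀

/-- The transform of a density is a transport map from the reference: up to null sets,
`{F₀ < F a} ⊆ {T ≤ a} ⊆ {F₀ ≤ F a}` for the cumulations `F₀`, `F` and the transform `T`. -/
theorem map_cdt (h : IsReference u) (h₀ : IsReference s₀) :
    (refMeasure s₀).map (cdt s₀ u) = refMeasure u := by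
  have := h₀.isProbabilityMeasure
  have hm := aemeasurable_of_monotoneOn_properSet h₀ (cdt_monotoneOn h h₀)
  have := Measure.isProbabilityMeasure_map hm
  have hae : ∀ᵐ x ∂refMeasure s₀, x ∈ properSet s₀ := refMeasure_properSet_compl h₀
  refine Measure.ext_of_Iic _ _ fun a => ?_
  rw [Measure.map_apply_of_aemeasurable hm measurableSet_Iic, h.refMeasure_Iic]
  refine le_antisymm ?_ ?_
  · refine (measure_mono_ae ?_).trans (h₀.refMeasure_cumulation_le (c := cumulation u a))
    filter_upwards [hae] with x hx hxa
    have hxa : sInf {z | cumulation s₀ x < cumulation u z} ≤ a := hxa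
    have ht : Filter.Tendsto (cumulation u) (nhdsWithin a (Ioi a)) (nhds (cumulation u a)) :=
      h.cumulation_continuous.continuousAt.tendsto.mono_left nhdsWithin_le_nhds
    refine ge_of_tendsto ht ?_
    filter_upwards [self_mem_nhdsWithin] with z hz
    obtain ⟨w, hw, hwz⟩ := exists_lt_of_csInf_lt (h.exists_lt_cumulation hx.2)
      (lt_of_le_of_lt hxa hz)
    exact (lt_of_lt_of_le hw (h.cumulation_mono hwz.le)).le
  · refine (h₀.le_refMeasure_cumulation_lt (h.cumulation_le_one a)).trans (measure_mono_ae ?_)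
    filter_upwards [hae] with x hx hxa
    exact csInf_le (bddBelow_lt_cumulation h hx.1) hxa

/-! ### Parts of integrable signals -/

theorem l1Norm_nonneg (u : ℝ → ℝ) : 0 ≤ l1Norm u := integral_nonneg fun _ => abs_nonneg _

theorem l1Norm_of_nonneg (hu : ∀ x, 0 ≤ u x) : l1Norm u = ∫ x, u x := by
  simp only [l1Norm, abs_of_nonneg (hu _)]

theorem isReference_normalize (hu : ∀ x, 0 ≤ u x) (hi : Integrable u) (h0 : l1Norm u ≠ 0) :
    IsReference (normalize u) where
  nonneg x := div_nonneg (hu x) (l1Norm_nonneg u)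
  integrable := hi.div_const _
  integral_eq_one := by
    simp only [normalize]
    rw [integral_div, ← l1Norm_of_nonneg hu, div_self h0]

theorem cdtOrZero_monotoneOn (h₀ : IsReference s₀) (hu : ∀ x, 0 ≤ u x) (hi : Integrable u) :
    MonotoneOn (cdtOrZero s₀ u) (properSet s₀) := by
  unfold cdtOrZero
  split_ifs with h
  · exact monotoneOn_const
  · exact cdt_monotoneOn (isReference_normalize hu hi h) h₀

theorem cdtOrZero_aemeasurable (h₀ : IsReference s₀) (hu : ∀ x, 0 ≤ u x) (hi : Integrable u) :
    AEMeasurable (cdtOrZero s₀ u) (refMeasure s₀) :=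
  aemeasurable_of_monotoneOn_properSet h₀ (cdtOrZero_monotoneOn h₀ hu hi)

/-- The transform of a part is a transport map from the reference to the normalized part; for a
trivial part both sides are the unit mass at the origin. -/
theorem map_cdtOrZero (h₀ : IsReference s₀) (hu : ∀ x, 0 ≤ u x) (hi : Integrable u) :
    (refMeasure s₀).map (cdtOrZero s₀ u) = normalizedMeasure u := by
  have := h₀.isProbabilityMeasure
  unfold cdtOrZero normalizedMeasure
  split_ifs with h
  · have : (0 : ℝ → ℝ) = fun _ => 0 := rfl
    rw [this, Measure.map_const, measure_univ, one_smul]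
  · exact map_cdt (isReference_normalize hu hi h) h₀

theorem wassersteinSq_normalizedMeasure (h₀ : IsReference s₀) (hu : ∀ x, 0 ≤ u x)
    (hui : Integrable u) (hv : ∀ x, 0 ≤ v x) (hvi : Integrable v) :
    wassersteinSq (normalizedMeasure u) (normalizedMeasure v)
      = eLpNorm (cdtOrZero s₀ u - cdtOrZero s₀ v) 2 (refMeasure s₀) ^ 2 := by
  have := h₀.isProbabilityMeasure
  rw [← map_cdtOrZero h₀ hu hui, ← map_cdtOrZero h₀ hv hvi,
    wassersteinSq_map_map (refMeasure_properSet_compl h₀) (cdtOrZero_monotoneOn h₀ hu hui)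
      (cdtOrZero_monotoneOn h₀ hv hvi) (cdtOrZero_aemeasurable h₀ hu hui)
      (cdtOrZero_aemeasurable h₀ hv hvi), eLpNorm_two_sq]
  rfl

theorem positivePart_nonneg (s : ℝ → ℝ) (x : ℝ) : 0 ≤ positivePart s x := le_max_left _ _

theorem negativePart_nonneg (s : ℝ → ℝ) (x : ℝ) : 0 ≤ negativePart s x := le_max_left _ _

theorem integrable_positivePart {s : ℝ → ℝ} (hs : Integrable s) : Integrable (positivePart s) := by
  refine hs.pos_part.congr (.of_forall fun x => ?_)
  exact max_comm _ _

theorem negativePart_eq (s : ℝ → ℝ) : negativePart s = positivePart (-s) := rfl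

theorem integrable_negativePart {s : ℝ → ℝ} (hs : Integrable s) : Integrable (negativePart s) :=
  integrable_positivePart hs.neg

/-- The Wasserstein part of the distance is the distance of the shapes in transform space. -/
theorem wassersteinFunctional_eq_shapeDistSq (h₀ : IsReference s₀) {r s : ℝ → ℝ}
    (hr : Integrable r) (hs : Integrable s) :
    wassersteinFunctional r s = shapeDistSq s₀ (scdt s₀ r) (scdt s₀ s) := by
  unfold wassersteinFunctional shapeDistSq
  rw [wassersteinSq_normalizedMeasure h₀ (positivePart_nonneg r) (integrable_positivePart hr)
      (positivePart_nonneg s) (integrable_positivePart hs),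
    wassersteinSq_normalizedMeasure h₀ (negativePart_nonneg r) (integrable_negativePart hr)
      (negativePart_nonneg s) (integrable_negativePart hs)]
  rfl

theorem distS_eq_transformDist (h₀ : IsReference s₀) {r s : ℝ → ℝ}
    (hr : Integrable r) (hs : Integrable s) :
    distS r s = transformDist s₀ (scdt s₀ r) (scdt s₀ s) := by
  unfold distS transformDist
  rw [wassersteinFunctional_eq_shapeDistSq h₀ hr hs]
  rfl

end Transform

/-! ### Change of variables for warped signals -/

namespace IsWarp

variable {I : Set ℝ} {g : ℝ → ℝ}

theorem invFunOn_mem {t : ℝ} (ht : t ∈ g '' I) : Function.invFunOn g I t ∈ I :=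
  Function.invFunOn_mem ht

theorem invFunOn_eq {t : ℝ} (ht : t ∈ g '' I) : g (Function.invFunOn g I t) = t :=
  Function.invFunOn_eq ht

theorem invFunOn_apply (h : StrictMonoOn g I) {x : ℝ} (hx : x ∈ I) :
    Function.invFunOn g I (g x) = x :=
  h.injOn (invFunOn_mem ⟨x, hx, rfl⟩) hx (invFunOn_eq ⟨x, hx, rfl⟩)

theorem strictMonoOn_invFunOn (h : StrictMonoOn g I) :
    StrictMonoOn (Function.invFunOn g I) (g '' I) := by
  intro a ha b hb hab
  by_contra hlt
  have := h.monotoneOn (invFunOn_mem hb) (invFunOn_mem ha) (not_lt.1 hlt)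
  rw [invFunOn_eq ha, invFunOn_eq hb] at this
  exact absurd hab (not_lt.2 this)

theorem ordConnected_image (h : IsWarp I g) : (g '' I).OrdConnected :=
  (h.ordConnected.isPreconnected.image g h.continuousOn).ordConnected

/-- The points inside `g(I)` at which the inverse of `g` on `I` is differentiable. -/
def regularSet (I : Set ℝ) (g : ℝ → ℝ) : Set ℝ :=
  interior (g '' I) ∩ {t | DifferentiableAt ℝ (Function.invFunOn g I) t}

theorem measurableSet_regularSet : MeasurableSet (regularSet I g) :=
  isOpen_interior.measurableSet.inter (measurableSet_of_differentiableAt ℝ _)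

theorem regularSet_subset : regularSet I g ⊆ g '' I := inter_subset_left.trans interior_subset

theorem hasDerivWithinAt_invFunOn {s : Set ℝ} (hs : s ⊆ regularSet I g) :
    ∀ t ∈ s, HasDerivWithinAt (Function.invFunOn g I) (deriv (Function.invFunOn g I) t) s t :=
  fun _ ht => (hs ht).2.hasDerivAt.hasDerivWithinAt

theorem injOn_invFunOn {s : Set ℝ} (hs : s ⊆ regularSet I g) :
    InjOn (Function.invFunOn g I) s := by
  intro a ha b hb hab
  rw [← invFunOn_eq (regularSet_subset (hs ha)), hab, invFunOn_eq (regularSet_subset (hs hb))]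

theorem deriv_invFunOn_nonneg (h : IsWarp I g) {t : ℝ} (ht : t ∈ interior (g '' I)) :
    0 ≤ deriv (Function.invFunOn g I) t := by
  rw [← derivWithin_of_isOpen isOpen_interior ht]
  exact ((strictMonoOn_invFunOn h.strictMonoOn).monotoneOn.mono interior_subset).derivWithin_nonneg

/-- By the fundamental theorem of calculus for absolutely continuous functions, the image of the
regular points fills a compact interval up to a null set. -/
theorem volume_Icc_diff_image_regularSet (h : IsWarp I g) {x y : ℝ} (hx : x ∈ I) (hy : y ∈ I)
    (hxy : x ≤ y) : volume (Icc x y \ Function.invFunOn g I '' regularSet I g) = 0 := by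
  set f := Function.invFunOn g I with hf
  have hab : g x ≤ g y := h.strictMonoOn.monotoneOn hx hy hxy
  have hsub : Icc (g x) (g y) ⊆ g '' I :=
    h.ordConnected_image.out (mem_image_of_mem g hx) (mem_image_of_mem g hy)
  have hac := h.inverse_ac _ _ hab hsub
  have hmono : MonotoneOn f (g '' I) := (strictMonoOn_invFunOn h.strictMonoOn).monotoneOn
  have hIoo : Ioo (g x) (g y) ⊆ interior (g '' I) :=
    interior_maximal (Ioo_subset_Icc_self.trans hsub) isOpen_Ioo
  set A := regularSet I g ∩ Ioo (g x) (g y) with hA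
  have hAm : MeasurableSet A := measurableSet_regularSet.inter measurableSet_Ioo
  have hAsub : A ⊆ regularSet I g := inter_subset_left
  have hAae : A =ᵐ[volume] Ioo (g x) (g y) := by
    filter_upwards [hac.ae_differentiableAt] with t ht
    refine eq_iff_iff.2 ⟨fun hta => hta.2, fun hta => ⟨⟨hIoo hta, ?_⟩, hta⟩⟩
    exact ht (by rw [uIcc_of_le hab]; exact Ioo_subset_Icc_self hta)
  have hvol : volume (f '' A) = volume (Icc x y) := by
    have h1 := lintegral_image_eq_lintegral_abs_deriv_mul hAm (hasDerivWithinAt_invFunOn hAsub)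
      (injOn_invFunOn hAsub) (fun _ => 1)
    simp only [mul_one, lintegral_const, Measure.restrict_apply MeasurableSet.univ, univ_inter,
      one_mul] at h1
    have h2 : ∫⁻ t in A, ENNReal.ofReal |deriv f t|
        = ∫⁻ t in Ioc (g x) (g y), ENNReal.ofReal (deriv f t) := by
      rw [setLIntegral_congr hAae, ← setLIntegral_congr Ioo_ae_eq_Ioc]
      refine setLIntegral_congr_fun measurableSet_Ioo fun t ht => ?_
      simp only [abs_of_nonneg (h.deriv_invFunOn_nonneg (hIoo ht)), hf]
    rw [h1, h2, ← ofReal_integral_eq_lintegral_ofReal, ← intervalIntegral.integral_of_le hab,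
      hac.integral_deriv_eq_sub, invFunOn_apply h.strictMonoOn hx,
      invFunOn_apply h.strictMonoOn hy, Real.volume_Icc]
    · exact (intervalIntegrable_iff_integrableOn_Ioc_of_le hab).1 hac.intervalIntegrable_deriv
    · rw [← restrict_Ioo_eq_restrict_Ioc]
      filter_upwards [ae_restrict_mem measurableSet_Ioo] with t ht
      exact h.deriv_invFunOn_nonneg (hIoo ht)
  have hfA : f '' A ⊆ Icc x y := by
    rintro _ ⟨t, ht, rfl⟩
    have htJ := regularSet_subset ht.1
    constructor
    · rw [← invFunOn_apply h.strictMonoOn hx]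
      exact hmono (mem_image_of_mem g hx) htJ ht.2.1.le
    · rw [← invFunOn_apply h.strictMonoOn hy]
      exact hmono htJ (mem_image_of_mem g hy) ht.2.2.le
  refine measure_mono_null (sdiff_subset_sdiff_right (image_mono hAsub)) ?_
  rw [measure_sdiff hfA (hAm.image_of_monotoneOn
    (hmono.mono (hAsub.trans regularSet_subset))).nullMeasurableSet, hvol, tsub_self]
  rw [hvol]; exact measure_Icc_lt_top.ne

/-- The image of the regular points fills the interval `I` up to a null set. -/
theorem volume_diff_image_regularSet (h : IsWarp I g) :
    volume (I \ Function.invFunOn g I '' regularSet I g) = 0 := by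
  have h1 : volume (interior I \ Function.invFunOn g I '' regularSet I g) = 0 := by
    refine measure_null_of_locally_null _ fun x hx => ?_
    obtain ⟨ε, hε, hb⟩ := Metric.nhds_basis_closedBall.mem_iff.1
      (isOpen_interior.mem_nhds hx.1)
    rw [Real.closedBall_eq_Icc] at hb
    have hb' := hb.trans interior_subset
    refine ⟨Icc (x - ε) (x + ε) \ Function.invFunOn g I '' regularSet I g, ?_,
      h.volume_Icc_diff_image_regularSet (hb' (left_mem_Icc.2 (by linarith)))
        (hb' (right_mem_Icc.2 (by linarith))) (by linarith)⟩
    filter_upwards [self_mem_nhdsWithin, mem_nhdsWithin_of_mem_nhds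
      (Icc_mem_nhds (sub_lt_self x hε) (lt_add_of_pos_right x hε))] with y hy hy'
    exact ⟨hy', hy.2⟩
  refine measure_mono_null ?_ (measure_union_null h1 (h.ordConnected.convex.addHaar_frontier volume))
  intro x hx
  by_cases hxi : x ∈ interior I
  · exact Or.inl ⟨hxi, hx.2⟩
  · exact Or.inr ⟨subset_closure hx.1, hxi⟩

/-- Almost every point of `g(I)` is regular. -/
theorem ae_mem_regularSet (h : IsWarp I g) : ∀ᵐ t, t ∈ g '' I → t ∈ regularSet I g := by
  have h1 : volume (frontier (g '' I)) = 0 := h.ordConnected_image.convex.addHaar_frontier volume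
  have h2 : volume (interior (g '' I) \ regularSet I g) = 0 := by
    refine measure_null_of_locally_null _ fun x hx => ?_
    obtain ⟨ε, hε, hb⟩ := Metric.nhds_basis_closedBall.mem_iff.1
      (isOpen_interior.mem_nhds hx.1)
    rw [Real.closedBall_eq_Icc] at hb
    have hle : x - ε ≤ x + ε := by linarith
    have hac := h.inverse_ac _ _ hle (hb.trans interior_subset)
    refine ⟨Icc (x - ε) (x + ε) \ regularSet I g, ?_, ?_⟩
    · filter_upwards [self_mem_nhdsWithin, mem_nhdsWithin_of_mem_nhds
        (Icc_mem_nhds (sub_lt_self x hε) (lt_add_of_pos_right x hε))] with y hy hy'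
      exact ⟨hy', hy.2⟩
    · refine measure_mono_null ?_ (ae_iff.1 hac.ae_differentiableAt)
      intro y hy hyd
      exact hy.2 ⟨hb hy.1, hyd (by rw [uIcc_of_le hle]; exact hy.1)⟩
  refine measure_mono_null ?_ (measure_union_null h1 h2)
  intro t ht
  rw [mem_compl_iff, mem_ofPred_eq, Classical.not_imp] at ht
  by_cases hti : t ∈ interior (g '' I)
  · exact Or.inr ⟨hti, ht.2⟩
  · exact Or.inl ⟨subset_closure ht.1, hti⟩

/-- Up to a null set, the warped signal lives on the regular points. -/
theorem warpedSignal_ae_eq (h : IsWarp I g) (r : ℝ → ℝ) :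
    warpedSignal I g r =ᵐ[volume] (regularSet I g).indicator
      (fun t => |deriv (Function.invFunOn g I) t| * r (Function.invFunOn g I t)) := by
  filter_upwards [h.ae_mem_regularSet] with t ht
  by_cases htJ : t ∈ g '' I
  · rw [warpedSignal, indicator_of_mem htJ, indicator_of_mem (ht htJ),
      abs_of_nonneg (h.deriv_invFunOn_nonneg (ht htJ).1)]
  · rw [warpedSignal, indicator_of_notMem htJ,
      indicator_of_notMem fun hr => htJ (regularSet_subset hr)]

theorem integrable_warpedSignal (h : IsWarp I g) {r : ℝ → ℝ} (hr : Integrable r) :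
    Integrable (warpedSignal I g r) := by
  refine Integrable.congr ?_ (h.warpedSignal_ae_eq r).symm
  rw [integrable_indicator_iff measurableSet_regularSet]
  exact (integrableOn_image_iff_integrableOn_abs_deriv_smul measurableSet_regularSet
    (hasDerivWithinAt_invFunOn Subset.rfl) (injOn_invFunOn Subset.rfl) r).1 hr.integrableOn

/-- Warping commutes with taking parts because the inverse of a warp has a non-negative
derivative. -/
theorem positivePart_warpedSignal (h : IsWarp I g) (r : ℝ → ℝ) :
    positivePart (warpedSignal I g r) =ᵐ[volume] warpedSignal I g (positivePart r) := by
  filter_upwards [h.warpedSignal_ae_eq r, h.warpedSignal_ae_eq (positivePart r)] with t h1 h2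
  rw [h2, positivePart, h1]
  by_cases ht : t ∈ regularSet I g
  · rw [indicator_of_mem ht, indicator_of_mem ht, positivePart, mul_max_of_nonneg _ _ (abs_nonneg _),
      mul_zero]
  · rw [indicator_of_notMem ht, indicator_of_notMem ht, max_self]

theorem negativePart_warpedSignal (h : IsWarp I g) (r : ℝ → ℝ) :
    negativePart (warpedSignal I g r) =ᵐ[volume] warpedSignal I g (negativePart r) := by
  have : -warpedSignal I g r = warpedSignal I g (-r) := by
    funext t
    by_cases ht : t ∈ g '' I
    · simp only [warpedSignal, Pi.neg_apply, indicator_of_mem ht, mul_neg]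
    · simp only [warpedSignal, Pi.neg_apply, indicator_of_notMem ht, neg_zero]
  rw [negativePart_eq, negativePart_eq, this]
  exact h.positivePart_warpedSignal _

variable {u : ℝ → ℝ}

theorem refMeasure_compl_eq_zero (h : IsWarp I g) (hI : ∀ᵐ x, x ∉ I → u x = 0) :
    refMeasure u Iᶜ = 0 := by
  rw [refMeasure, withDensity_apply _ h.ordConnected.measurableSet.compl,
    setLIntegral_congr_fun_ae (g := fun _ => 0) h.ordConnected.measurableSet.compl, lintegral_zero]
  filter_upwards [hI] with x hx hxI
  simp [hx hxI]

theorem aemeasurable_refMeasure (h : IsWarp I g) (hI : ∀ᵐ x, x ∉ I → u x = 0) :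
    AEMeasurable g (refMeasure u) := by
  have := aemeasurable_restrict_of_monotoneOn (μ := refMeasure u) h.ordConnected.measurableSet
    h.strictMonoOn.monotoneOn
  rwa [Measure.restrict_eq_self_of_ae_mem] at this
  exact h.refMeasure_compl_eq_zero hI

/-- The change of variables: warping the density of a measure amounts to pushing the measure
forward by `g`. -/
theorem refMeasure_warpedSignal (h : IsWarp I g) (hI : ∀ᵐ x, x ∉ I → u x = 0) :
    refMeasure (warpedSignal I g u) = (refMeasure u).map g := by
  set f := Function.invFunOn g I with hf
  ext E hE
  rw [Measure.map_apply_of_aemeasurable (h.aemeasurable_refMeasure hI) hE]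
  have hAm : MeasurableSet (regularSet I g ∩ E) := measurableSet_regularSet.inter hE
  have hAsub : regularSet I g ∩ E ⊆ regularSet I g := inter_subset_left
  have hG : I ∩ g ⁻¹' E = f '' (g '' I ∩ E) := by
    ext x
    constructor
    · rintro ⟨hx, hxE⟩
      exact ⟨g x, ⟨⟨x, hx, rfl⟩, hxE⟩, invFunOn_apply h.strictMonoOn hx⟩
    · rintro ⟨t, ⟨htJ, htE⟩, rfl⟩
      refine ⟨invFunOn_mem htJ, ?_⟩
      rw [mem_preimage, invFunOn_eq htJ]
      exact htE
  have hGm : MeasurableSet (I ∩ g ⁻¹' E) := by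
    rw [hG]
    exact (h.ordConnected_image.measurableSet.inter hE).image_of_monotoneOn
      ((strictMonoOn_invFunOn h.strictMonoOn).monotoneOn.mono inter_subset_left)
  have himg : f '' (regularSet I g ∩ E) =ᵐ[volume] (I ∩ g ⁻¹' E : Set ℝ) := by
    have : ∀ᵐ x, ¬ x ∈ I \ f '' regularSet I g :=
      measure_eq_zero_iff_ae_notMem.1 h.volume_diff_image_regularSet
    filter_upwards [this] with x hx
    refine eq_iff_iff.2 ⟨?_, fun hxG => ?_⟩
    · rintro ⟨t, ht, rfl⟩
      rw [hG]
      exact ⟨t, ⟨regularSet_subset ht.1, ht.2⟩, rfl⟩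
    · have hxD : x ∈ f '' regularSet I g := by
        by_contra hn; exact hx ⟨hxG.1, hn⟩
      obtain ⟨t, ht, rfl⟩ := hxD
      refine ⟨t, ⟨ht, ?_⟩, rfl⟩
      have := hxG.2
      rwa [mem_preimage, invFunOn_eq (regularSet_subset ht)] at this
  calc refMeasure (warpedSignal I g u) E
      = ∫⁻ t in E, (regularSet I g).indicator
          (fun t => ENNReal.ofReal |deriv f t| * ENNReal.ofReal (u (f t))) t := by
        rw [refMeasure, withDensity_apply _ hE]
        refine setLIntegral_congr_fun_ae hE ?_
        filter_upwards [h.warpedSignal_ae_eq u] with t ht _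
        rw [ht]
        by_cases htr : t ∈ regularSet I g
        · rw [indicator_of_mem htr, indicator_of_mem htr, ENNReal.ofReal_mul (abs_nonneg _)]
        · rw [indicator_of_notMem htr, indicator_of_notMem htr, ENNReal.ofReal_zero]
    _ = ∫⁻ t in regularSet I g ∩ E, ENNReal.ofReal |deriv f t| * ENNReal.ofReal (u (f t)) := by
        rw [lintegral_indicator measurableSet_regularSet,
          Measure.restrict_restrict measurableSet_regularSet]
    _ = ∫⁻ x in f '' (regularSet I g ∩ E), ENNReal.ofReal (u x) :=
        (lintegral_image_eq_lintegral_abs_deriv_mul hAm (hasDerivWithinAt_invFunOn hAsub)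
          (injOn_invFunOn hAsub) (fun x => ENNReal.ofReal (u x))).symm
    _ = refMeasure u (I ∩ g ⁻¹' E) := by
        rw [setLIntegral_congr himg, refMeasure, withDensity_apply _ hGm]
    _ = refMeasure u (g ⁻¹' E) := by
        refine measure_congr ?_
        have : ∀ᵐ x ∂refMeasure u, x ∈ I := h.refMeasure_compl_eq_zero hI
        filter_upwards [this] with x hx
        exact eq_iff_iff.2 ⟨fun hxG => hxG.2, fun hxG => ⟨hx, hxG⟩⟩

end IsWarp

/-! ### The transform of a warped signal -/

section WarpedTransform

variable {s₀ u w : ℝ → ℝ} {I : Set ℝ} {g : ℝ → ℝ}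

theorem refMeasure_congr (h : u =ᵐ[volume] w) : refMeasure u = refMeasure w :=
  withDensity_congr_ae (h.mono fun x hx => by simp only [hx])

theorem refMeasure_univ_eq_l1Norm (hu : ∀ x, 0 ≤ u x) (hi : Integrable u) :
    refMeasure u univ = ENNReal.ofReal (l1Norm u) := by
  rw [refMeasure, withDensity_apply _ MeasurableSet.univ, Measure.restrict_univ,
    l1Norm_of_nonneg hu, ofReal_integral_eq_lintegral_ofReal hi (.of_forall hu)]

theorem warpedSignal_div_const (c : ℝ) :
    warpedSignal I g (fun x => u x / c) = fun t => warpedSignal I g u t / c := by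
  funext t
  by_cases ht : t ∈ g '' I
  · simp only [warpedSignal, indicator_of_mem ht, mul_div_assoc]
  · simp only [warpedSignal, indicator_of_notMem ht, zero_div]

/-- A warp preserves the mass of a non-negative signal. -/
theorem l1Norm_warpedSignal (h : IsWarp I g) (hu : ∀ x, 0 ≤ u x) (hui : Integrable u)
    (hI : ∀ᵐ x, x ∉ I → u x = 0) (hw : ∀ x, 0 ≤ w x) (hwi : Integrable w)
    (hwu : w =ᵐ[volume] warpedSignal I g u) : l1Norm w = l1Norm u := by
  have h1 := congrArg (fun μ => μ univ) (h.refMeasure_warpedSignal hI)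
  simp only [← refMeasure_congr hwu, refMeasure_univ_eq_l1Norm hw hwi,
    Measure.map_apply_of_aemeasurable (h.aemeasurable_refMeasure hI) MeasurableSet.univ,
    preimage_univ, refMeasure_univ_eq_l1Norm hu hui] at h1
  exact (ENNReal.ofReal_eq_ofReal_iff (l1Norm_nonneg _) (l1Norm_nonneg _)).1 h1

/-- The composition property: `g ∘ û` and the transform of the warped signal are increasing
transport maps between the same measures, hence agree almost everywhere. -/
theorem cdtOrZero_warpedSignal (h₀ : IsReference s₀) (h : IsWarp I g) (hu : ∀ x, 0 ≤ u x)
    (hui : Integrable u) (hI : ∀ᵐ x, x ∉ I → u x = 0) (hw : ∀ x, 0 ≤ w x) (hwi : Integrable w)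
    (hwu : w =ᵐ[volume] warpedSignal I g u) (hne : l1Norm u ≠ 0) :
    cdtOrZero s₀ w =ᵐ[refMeasure s₀] g ∘ cdtOrZero s₀ u := by
  have := h₀.isProbabilityMeasure
  have hmass : l1Norm w = l1Norm u := l1Norm_warpedSignal h hu hui hI hw hwi hwu
  have hne' : l1Norm w ≠ 0 := hmass ▸ hne
  simp only [cdtOrZero, if_neg hne, if_neg hne']
  have hru := isReference_normalize hu hui hne
  have hrw := isReference_normalize hw hwi hne'
  have hnI : ∀ᵐ x, x ∉ I → normalize u x = 0 := by
    filter_upwards [hI] with x hx hxI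
    simp [normalize, hx hxI]
  have hnw : normalize w =ᵐ[volume] warpedSignal I g (normalize u) := by
    unfold normalize
    rw [warpedSignal_div_const, hmass]
    filter_upwards [hwu] with x hx
    rw [hx]
  have hTm := aemeasurable_of_monotoneOn_properSet h₀ (cdt_monotoneOn hru h₀)
  have hWm := aemeasurable_of_monotoneOn_properSet h₀ (cdt_monotoneOn hrw h₀)
  have hgm : AEMeasurable g ((refMeasure s₀).map (cdt s₀ (normalize u))) := by
    rw [map_cdt hru h₀]; exact h.aemeasurable_refMeasure hnI
  -- almost every value of the transform lies in `I`, where `g` increases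
  have hS : refMeasure s₀ (properSet s₀ ∩ cdt s₀ (normalize u) ⁻¹' I)ᶜ = 0 := by
    rw [compl_inter]
    refine measure_union_null (refMeasure_properSet_compl h₀) ?_
    rw [← preimage_compl, ← Measure.map_apply_of_aemeasurable hTm
      h.ordConnected.measurableSet.compl, map_cdt hru h₀]
    exact h.refMeasure_compl_eq_zero hnI
  refine ae_eq_of_map_eq_of_monotoneOn hS ((cdt_monotoneOn hrw h₀).mono inter_subset_left) ?_
    hWm (hgm.comp_aemeasurable hTm) ?_
  · intro x hx y hy hxy
    exact h.strictMonoOn.monotoneOn hx.2 hy.2 (cdt_monotoneOn hru h₀ hx.1 hy.1 hxy)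
  · rw [← AEMeasurable.map_map_of_aemeasurable hgm hTm, map_cdt hru h₀, map_cdt hrw h₀,
      refMeasure_congr hnw, h.refMeasure_warpedSignal hnI]

theorem cdtOrZero_warpedSignal_ite (h₀ : IsReference s₀) (h : IsWarp I g) (hu : ∀ x, 0 ≤ u x)
    (hui : Integrable u) (hI : ∀ᵐ x, x ∉ I → u x = 0) (hw : ∀ x, 0 ≤ w x) (hwi : Integrable w)
    (hwu : w =ᵐ[volume] warpedSignal I g u) [Decidable (l1Norm u = 0)] :
    cdtOrZero s₀ w =ᵐ[refMeasure s₀] if l1Norm u = 0 then 0 else g ∘ cdtOrZero s₀ u := by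
  split_ifs with hne
  · have hmass : l1Norm w = 0 := (l1Norm_warpedSignal h hu hui hI hw hwi hwu).trans hne
    simp only [cdtOrZero, if_pos hmass]
    rfl
  · exact cdtOrZero_warpedSignal h₀ h hu hui hI hw hwi hwu hne

section Signed

variable {r : ℝ → ℝ}

theorem ae_positivePart_eq_zero (hI : ∀ᵐ x, x ∉ I → r x = 0) :
    ∀ᵐ x, x ∉ I → positivePart r x = 0 := by
  filter_upwards [hI] with x hx hxI
  simp [positivePart, hx hxI]

theorem ae_negativePart_eq_zero (hI : ∀ᵐ x, x ∉ I → r x = 0) :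
    ∀ᵐ x, x ∉ I → negativePart r x = 0 := by
  filter_upwards [hI] with x hx hxI
  simp [negativePart, hx hxI]

theorem scdt_warpedSignal_pos (h₀ : IsReference s₀) (h : IsWarp I g) (hr : Integrable r)
    (hI : ∀ᵐ x, x ∉ I → r x = 0) :
    (scdt s₀ (warpedSignal I g r)).pos =ᵐ[refMeasure s₀] (comp g (scdt s₀ r)).pos :=
  cdtOrZero_warpedSignal_ite h₀ h (positivePart_nonneg r) (integrable_positivePart hr)
    (ae_positivePart_eq_zero hI) (positivePart_nonneg _)
    (integrable_positivePart (h.integrable_warpedSignal hr)) (h.positivePart_warpedSignal r)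

theorem scdt_warpedSignal_neg (h₀ : IsReference s₀) (h : IsWarp I g) (hr : Integrable r)
    (hI : ∀ᵐ x, x ∉ I → r x = 0) :
    (scdt s₀ (warpedSignal I g r)).neg =ᵐ[refMeasure s₀] (comp g (scdt s₀ r)).neg :=
  cdtOrZero_warpedSignal_ite h₀ h (negativePart_nonneg r) (integrable_negativePart hr)
    (ae_negativePart_eq_zero hI) (negativePart_nonneg _)
    (integrable_negativePart (h.integrable_warpedSignal hr)) (h.negativePart_warpedSignal r)

theorem scdt_warpedSignal_posMass (h : IsWarp I g) (hr : Integrable r)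
    (hI : ∀ᵐ x, x ∉ I → r x = 0) :
    (scdt s₀ (warpedSignal I g r)).posMass = (scdt s₀ r).posMass :=
  l1Norm_warpedSignal h (positivePart_nonneg r) (integrable_positivePart hr)
    (ae_positivePart_eq_zero hI) (positivePart_nonneg _)
    (integrable_positivePart (h.integrable_warpedSignal hr)) (h.positivePart_warpedSignal r)

theorem scdt_warpedSignal_negMass (h : IsWarp I g) (hr : Integrable r)
    (hI : ∀ᵐ x, x ∉ I → r x = 0) :
    (scdt s₀ (warpedSignal I g r)).negMass = (scdt s₀ r).negMass :=
  l1Norm_warpedSignal h (negativePart_nonneg r) (integrable_negativePart hr)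
    (ae_negativePart_eq_zero hI) (negativePart_nonneg _)
    (integrable_negativePart (h.integrable_warpedSignal hr)) (h.negativePart_warpedSignal r)

theorem massGap_warpedSignal (h : IsWarp I g) (hr : Integrable r)
    (hI : ∀ᵐ x, x ∉ I → r x = 0) (s : ℝ → ℝ) :
    massGap (warpedSignal I g r) s = massGap r s := by
  -- the masses do not involve the reference, so any value of `s₀` will do
  have h1 := scdt_warpedSignal_posMass (s₀ := 0) h hr hI
  have h2 := scdt_warpedSignal_negMass (s₀ := 0) h hr hI
  simp only [scdt] at h1 h2
  rw [massGap, massGap, h1, h2]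

theorem shapeDistSq_congr {a b c : Transform} (hp : a.pos =ᵐ[refMeasure s₀] b.pos)
    (hn : a.neg =ᵐ[refMeasure s₀] b.neg) : shapeDistSq s₀ a c = shapeDistSq s₀ b c := by
  rw [shapeDistSq, shapeDistSq, eLpNorm_congr_ae (hp.sub .rfl), eLpNorm_congr_ae (hn.sub .rfl)]

theorem wassersteinFunctional_warpedSignal (h₀ : IsReference s₀) (h : IsWarp I g)
    (hr : Integrable r) (hI : ∀ᵐ x, x ∉ I → r x = 0) {s : ℝ → ℝ} (hs : Integrable s) :
    wassersteinFunctional (warpedSignal I g r) s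
      = shapeDistSq s₀ (comp g (scdt s₀ r)) (scdt s₀ s) := by
  rw [wassersteinFunctional_eq_shapeDistSq h₀ (h.integrable_warpedSignal hr) hs]
  exact shapeDistSq_congr (scdt_warpedSignal_pos h₀ h hr hI) (scdt_warpedSignal_neg h₀ h hr hI)

theorem distS_sq (r s : ℝ → ℝ) :
    distS r s ^ 2 = wassersteinFunctional r s + ENNReal.ofReal (massGap r s) := by
  rw [distS, ← ENNReal.rpow_natCast, ← ENNReal.rpow_mul]
  norm_num

/-- The squared distance from a warped signal, read off in transform space. -/
theorem distS_sq_warpedSignal (h₀ : IsReference s₀) (h : IsWarp I g)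
    (hr : Integrable r) (hI : ∀ᵐ x, x ∉ I → r x = 0) {s : ℝ → ℝ} (hs : Integrable s) :
    distS (warpedSignal I g r) s ^ 2
      = shapeDistSq s₀ (comp g (scdt s₀ r)) (scdt s₀ s) + ENNReal.ofReal (massGap r s) := by
  rw [distS_sq, wassersteinFunctional_warpedSignal h₀ h hr hI hs, massGap_warpedSignal h hr hI]

theorem distS_warpedSignal_eq_transformDist_comp (h₀ : IsReference s₀) (h : IsWarp I g)
    (hr : Integrable r) (hI : ∀ᵐ x, x ∉ I → r x = 0) {s : ℝ → ℝ} (hs : Integrable s) :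
    distS (warpedSignal I g r) s = transformDist s₀ (comp g (scdt s₀ r)) (scdt s₀ s) := by
  rw [distS, transformDist, wassersteinFunctional_warpedSignal h₀ h hr hI hs,
    massGap_warpedSignal h hr hI]
  rfl

end Signed

end WarpedTransform

/-! ### Increasing polynomials are warps -/

theorem _root_.AbsolutelyContinuousOnInterval.congr {f F : ℝ → ℝ} {a b : ℝ}
    (hF : AbsolutelyContinuousOnInterval F a b) (h : EqOn f F (uIcc a b)) :
    AbsolutelyContinuousOnInterval f a b := by
  rw [absolutelyContinuousOnInterval_iff] at hF ⊢
  intro ε hε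
  obtain ⟨δ, hδ, H⟩ := hF ε hε
  refine ⟨δ, hδ, fun E hE hlen => ?_⟩
  rw [Finset.sum_congr rfl fun i hi => by rw [h (hE.1 i hi).1, h (hE.1 i hi).2]]
  exact H E hE hlen

/-- A monotone continuous function that is differentiable off a countable set is absolutely
continuous, being the integral of its derivative. -/
theorem absolutelyContinuousOnInterval_of_monotoneOn {f : ℝ → ℝ} {a b : ℝ} (hab : a ≤ b)
    {S : Set ℝ} (hS : S.Countable) (hmono : MonotoneOn f (Icc a b))
    (hcont : ContinuousOn f (Icc a b)) (hdiff : ∀ t ∈ Ioo a b \ S, DifferentiableAt ℝ f t) :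
    AbsolutelyContinuousOnInterval f a b := by
  have hint : IntervalIntegrable (deriv f) volume a b :=
    MonotoneOn.intervalIntegrable_deriv (by rwa [uIcc_of_le hab])
  have hconst : AbsolutelyContinuousOnInterval (fun _ => f a) a b :=
    ((LipschitzWith.const (f a)).lipschitzOnWith
      (s := uIcc a b)).absolutelyContinuousOnInterval
  refine (hconst.add (hint.absolutelyContinuousOnInterval_intervalIntegral
    (c := a) left_mem_uIcc)).congr fun x hx => ?_
  rw [uIcc_of_le hab] at hx
  have hsub : Icc a x ⊆ Icc a b := Icc_subset_Icc_right hx.2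
  have := integral_eq_of_hasDerivAt_off_countable_of_le f (deriv f) hx.1 hS (hcont.mono hsub)
    (fun t ht => (hdiff t ⟨⟨ht.1.1, ht.1.2.trans_le hx.2⟩, ht.2⟩).hasDerivAt)
    (hint.mono_set (by rwa [uIcc_of_le hab, uIcc_of_le hx.1]))
  simp only [Pi.add_apply, this]
  ring

/-- A monotone function without gaps in its range is continuous. -/
theorem continuousOn_of_monotoneOn_of_surjOn {f : ℝ → ℝ} {a b : ℝ}
    (hmono : MonotoneOn f (Icc a b)) (hsurj : SurjOn f (Icc a b) (Icc (f a) (f b))) :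
    ContinuousOn f (Icc a b) := by
  have hmaps : ∀ t : Icc a b, f t ∈ Icc (f a) (f b) := fun t =>
    have hab := t.2.1.trans t.2.2
    ⟨hmono (left_mem_Icc.2 hab) t.2 t.2.1, hmono t.2 (right_mem_Icc.2 hab) t.2.2⟩
  let F : Icc a b → Icc (f a) (f b) := fun t => ⟨f t, hmaps t⟩
  have hF : Continuous F := by
    refine Monotone.continuous_of_surjective (fun x y hxy => hmono x.2 y.2 hxy) ?_
    rintro ⟨y, hy⟩
    obtain ⟨x, hx, rfl⟩ := hsurj hy
    exact ⟨⟨x, hx⟩, rfl⟩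
  rw [continuousOn_iff_continuous_domRestrict]
  exact continuous_subtype_val.comp hF

open Polynomial in
/-- The inverse of an increasing polynomial is differentiable except at the finitely many critical
values, which makes it absolutely continuous. -/
theorem isWarp_polynomial {I : Set ℝ} (hI : I.OrdConnected) (P : ℝ[X])
    (hP : StrictMonoOn (fun x => P.eval x) I) : IsWarp I (fun x => P.eval x) := by
  refine ⟨hI, hP, P.continuous.continuousOn, fun a b hab hsub => ?_⟩
  set g : ℝ → ℝ := fun x => P.eval x with hg
  set f := Function.invFunOn g I with hf
  have hfmono := IsWarp.strictMonoOn_invFunOn hP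
  have hfab : MonotoneOn f (Icc a b) := hfmono.monotoneOn.mono hsub
  have haJ := hsub (left_mem_Icc.2 hab)
  have hbJ := hsub (right_mem_Icc.2 hab)
  have hfa : g (f a) = a := IsWarp.invFunOn_eq haJ
  have hfb : g (f b) = b := IsWarp.invFunOn_eq hbJ
  have hsurj : SurjOn f (Icc a b) (Icc (f a) (f b)) := by
    intro x hx
    have haI := IsWarp.invFunOn_mem haJ
    have hbI := IsWarp.invFunOn_mem hbJ
    have hxI : x ∈ I := hI.out haI hbI hx
    refine ⟨g x, ⟨?_, ?_⟩, IsWarp.invFunOn_apply hP hxI⟩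
    · rw [← hfa]; exact hP.monotoneOn haI hxI hx.1
    · rw [← hfb]; exact hP.monotoneOn hxI hbI hx.2
  have hcont := continuousOn_of_monotoneOn_of_surjOn hfab hsurj
  refine absolutelyContinuousOnInterval_of_monotoneOn hab
    (S := g '' {x | x ∈ P.derivative.roots}) ?_ hfab hcont ?_
  · exact ((Multiset.finite_toSet P.derivative.roots).image g).countable
  · rintro t ⟨ht, htS⟩
    have htJ := hsub (Ioo_subset_Icc_self ht)
    have hgt : g (f t) = t := IsWarp.invFunOn_eq htJ
    have hder : P.derivative.eval (f t) ≠ 0 := by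
      intro h0
      refine htS ⟨f t, ?_, hgt⟩
      refine (Polynomial.mem_roots ?_).2 h0
      -- a constant polynomial is not increasing between `f a < f b`
      intro hd
      have hlt : a < b := ht.1.trans ht.2
      have hconst := Polynomial.derivative_eq_zero.1 hd
      rw [Polynomial.eq_C_of_natDegree_eq_zero hconst] at hg
      simp only [Polynomial.eval_C] at hg
      rw [hg] at hfa hfb
      exact hlt.ne (hfa.symm.trans hfb)
    have hnhds : Icc a b ∈ nhds t := Icc_mem_nhds ht.1 ht.2
    refine (HasDerivAt.of_local_left_inverse (hcont.continuousAt hnhds)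
      (P.hasDerivAt (f t)) hder ?_).differentiableAt
    filter_upwards [hnhds] with y hy
    exact IsWarp.invFunOn_eq (hsub hy)

open Polynomial in
theorem linModel_monomials_eq_eval (n : ℕ) (p : Fin (n + 1) → ℝ) :
    linModel (monomials n) p
      = fun x => (∑ k : Fin (n + 1), C (p k) * X ^ (k : ℕ) : ℝ[X]).eval x := by
  funext x
  simp [linModel, monomials, Polynomial.eval_finsetSum]

theorem isWarp_linModel_monomials {I : Set ℝ} {n : ℕ} {p : Fin (n + 1) → ℝ}
    (hI : I.OrdConnected) (hp : StrictMonoOn (linModel (monomials n) p) I) :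
    IsWarp I (linModel (monomials n) p) := by
  rw [linModel_monomials_eq_eval] at hp ⊢
  exact isWarp_polynomial hI _ hp

theorem isWarp_affine {ω : ℝ} (hω : 0 < ω) (τ : ℝ) : IsWarp univ (fun t => ω * t + τ) := by
  have heq : (fun t => ω * t + τ) = linModel (monomials 1) ![τ, ω] := by
    funext t
    simp [linModel, monomials, Fin.sum_univ_two, add_comm]
  rw [heq]
  refine isWarp_linModel_monomials ordConnected_univ ?_
  rw [← heq]
  intro x _ y _ hxy
  have := mul_lt_mul_of_pos_left hxy hω
  simp only
  linarith

theorem isWarp_quadratic {κ : ℝ} (hκ : 0 < κ) (τ : ℝ) :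
    IsWarp (Ici 0) (fun t => κ * t ^ 2 + τ) := by
  have heq : (fun t => κ * t ^ 2 + τ) = linModel (monomials 2) ![τ, 0, κ] := by
    funext t
    simp [linModel, monomials, Fin.sum_univ_three, add_comm]
  rw [heq]
  refine isWarp_linModel_monomials ordConnected_Ici ?_
  rw [← heq]
  intro x hx y _ hxy
  have := mul_lt_mul_of_pos_left (pow_lt_pow_left₀ hxy hx two_ne_zero) hκ
  simp only
  linarith

/-! ### Quadratic costs and the normal equations -/

section Quadratic

variable {m : ℕ} {G : Matrix (Fin m) (Fin m) ℝ} {b : Fin m → ℝ} {c : ℝ} {C : (Fin m → ℝ) → ℝ}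

theorem dotProduct_mulVec_comm (hG : G.IsSymm) (p q : Fin m → ℝ) :
    p ⬝ᵥ G.mulVec q = q ⬝ᵥ G.mulVec p := by
  rw [Matrix.dotProduct_mulVec, ← Matrix.mulVec_transpose, hG.eq, dotProduct_comm]

/-- A quadratic cost with a positive semidefinite matrix is convex: the convexity defect is
`a b (p - q)ᵀ G (p - q)`. -/
theorem convexOn_of_quadratic (hG : G.IsSymm) (hpos : ∀ p, 0 ≤ p ⬝ᵥ G.mulVec p)
    (hC : ∀ p, C p = p ⬝ᵥ G.mulVec p - 2 * (p ⬝ᵥ b) + c) : ConvexOn ℝ univ C := by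
  refine ⟨convex_univ, fun p _ q _ α β hα hβ hαβ => ?_⟩
  have h := mul_nonneg (mul_nonneg hα hβ) (hpos (p - q))
  have hs := dotProduct_mulVec_comm hG q p
  obtain rfl : β = 1 - α := by linarith
  simp only [hC, smul_eq_mul, Matrix.mulVec_add, Matrix.mulVec_sub, Matrix.mulVec_smul,
    dotProduct_add, add_dotProduct, dotProduct_sub, sub_dotProduct, dotProduct_smul,
    smul_dotProduct] at h ⊢
  rw [hs] at h ⊢
  linarith

theorem isUnit_det_of_quadratic_pos (hpos : ∀ p, p ≠ 0 → 0 < p ⬝ᵥ G.mulVec p) :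
    IsUnit G.det := by
  rw [← Matrix.isUnit_iff_isUnit_det, ← Matrix.mulVec_injective_iff_isUnit]
  refine (injective_iff_map_eq_zero G.mulVecLin).2 fun p hp => ?_
  by_contra hne
  have := hpos p hne
  rw [← Matrix.mulVecLin_apply, hp, dotProduct_zero] at this
  exact lt_irrefl _ this

/-- The solution of the normal equations is the strict global minimizer, by completing the
square. -/
theorem lt_of_quadratic_pos (hG : G.IsSymm) (hpos : ∀ p, p ≠ 0 → 0 < p ⬝ᵥ G.mulVec p)
    (hC : ∀ p, C p = p ⬝ᵥ G.mulVec p - 2 * (p ⬝ᵥ b) + c) {q : Fin m → ℝ}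
    (hq : q ≠ G⁻¹.mulVec b) : C (G⁻¹.mulVec b) < C q := by
  set p := G⁻¹.mulVec b with hp
  have hGp : b = G.mulVec p := by
    rw [hp, Matrix.mulVec_mulVec, Matrix.mul_nonsing_inv _ (isUnit_det_of_quadratic_pos hpos),
      Matrix.one_mulVec]
  have h := hpos (q - p) (sub_ne_zero.2 hq)
  have hs := dotProduct_mulVec_comm hG p q
  rw [hC, hC, hGp]
  simp only [Matrix.mulVec_sub, dotProduct_sub, sub_dotProduct] at h
  rw [hs] at h
  linarith

end Quadratic

/-! ### The discrete least-squares problem -/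

section Discrete

variable {m N M : ℕ}

theorem modelMatrix_mulVec (φ : Fin m → ℝ → ℝ) (u : Fin N → ℝ) (p : Fin m → ℝ) (i : Fin N) :
    (modelMatrix φ u).mulVec p i = linModel φ p (u i) := by
  simp [modelMatrix, linModel, Matrix.mulVec, dotProduct, mul_comm]

theorem discreteCost_eq_linModel (φ : Fin m → ℝ → ℝ) (rp sp : Fin N → ℝ) (rm sm : Fin M → ℝ)
    (p : Fin m → ℝ) : discreteCost φ rp sp rm sm p
      = (∑ i, (linModel φ p (rp i) - sp i) ^ 2) + ∑ i, (linModel φ p (rm i) - sm i) ^ 2 := by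
  simp only [discreteCost, modelMatrix_mulVec]

theorem discreteCost_eq_designMatrix (φ : Fin m → ℝ → ℝ) (rp sp : Fin N → ℝ)
    (rm sm : Fin M → ℝ) (p : Fin m → ℝ) : discreteCost φ rp sp rm sm p
      = ∑ i, ((designMatrix φ rp rm).mulVec p i - Sum.elim sp sm i) ^ 2 := by
  simp only [discreteCost, designMatrix, Fintype.sum_sum_type, Matrix.fromRows_mulVec,
    Sum.elim_inl, Sum.elim_inr]

variable {ι : Type} [Fintype ι]

theorem sum_sq_mulVec_sub (X : Matrix ι (Fin m) ℝ) (y : ι → ℝ) (p : Fin m → ℝ) :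
    ∑ i, (X.mulVec p i - y i) ^ 2
      = p ⬝ᵥ (X.transpose * X).mulVec p - 2 * (p ⬝ᵥ X.transpose.mulVec y) + y ⬝ᵥ y := by
  have h : ∀ z, p ⬝ᵥ X.transpose.mulVec z = X.mulVec p ⬝ᵥ z := fun z => by
    rw [Matrix.dotProduct_mulVec, Matrix.vecMul_transpose]
  rw [← Matrix.mulVec_mulVec, h, h]
  simp only [dotProduct, Finset.mul_sum, ← Finset.sum_sub_distrib, ← Finset.sum_add_distrib]
  exact Finset.sum_congr rfl fun i _ => by ring

theorem dotProduct_gram_mulVec (X : Matrix ι (Fin m) ℝ) (p : Fin m → ℝ) :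
    p ⬝ᵥ (X.transpose * X).mulVec p = ∑ i, X.mulVec p i ^ 2 := by
  simpa using (sum_sq_mulVec_sub X 0 p).symm

theorem isSymm_transpose_mul (X : Matrix ι (Fin m) ℝ) : (X.transpose * X).IsSymm := by
  rw [Matrix.IsSymm, Matrix.transpose_mul, Matrix.transpose_transpose]

theorem dotProduct_gram_mulVec_pos {X : Matrix ι (Fin m) ℝ} (hX : LinearIndependent ℝ X.col)
    (p : Fin m → ℝ) (hp : p ≠ 0) : 0 < p ⬝ᵥ (X.transpose * X).mulVec p := by
  rw [dotProduct_gram_mulVec]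
  refine lt_of_le_of_ne (Finset.sum_nonneg fun i _ => sq_nonneg _) fun h0 => hp ?_
  have hz := (Finset.sum_eq_zero_iff_of_nonneg fun i _ => sq_nonneg (X.mulVec p i)).1 h0.symm
  refine Matrix.mulVec_injective_iff.2 hX ?_
  rw [Matrix.mulVec_zero]
  exact funext fun i => pow_eq_zero_iff two_ne_zero |>.1 (hz i (Finset.mem_univ i))

theorem isUnit_det_transpose_mul {X : Matrix ι (Fin m) ℝ} (hX : LinearIndependent ℝ X.col) :
    IsUnit (X.transpose * X).det :=
  isUnit_det_of_quadratic_pos (dotProduct_gram_mulVec_pos hX)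

theorem sum_sq_leastSquaresSolution_lt {X : Matrix ι (Fin m) ℝ}
    (hX : LinearIndependent ℝ X.col) (y : ι → ℝ) {q : Fin m → ℝ}
    (hq : q ≠ leastSquaresSolution X y) :
    ∑ i, (X.mulVec (leastSquaresSolution X y) i - y i) ^ 2 < ∑ i, (X.mulVec q i - y i) ^ 2 :=
  lt_of_quadratic_pos (C := fun p => ∑ i, (X.mulVec p i - y i) ^ 2) (isSymm_transpose_mul X)
    (dotProduct_gram_mulVec_pos hX) (sum_sq_mulVec_sub X y) hq

theorem convexOn_sum_sq_mulVec_sub (X : Matrix ι (Fin m) ℝ) (y : ι → ℝ) :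
    ConvexOn ℝ univ fun p => ∑ i, (X.mulVec p i - y i) ^ 2 :=
  convexOn_of_quadratic (isSymm_transpose_mul X)
    (fun p => by rw [dotProduct_gram_mulVec]; exact Finset.sum_nonneg fun i _ => sq_nonneg _)
    (sum_sq_mulVec_sub X y)

theorem convexOn_discreteCost (φ : Fin m → ℝ → ℝ) (rp sp : Fin N → ℝ) (rm sm : Fin M → ℝ) :
    ConvexOn ℝ univ (discreteCost φ rp sp rm sm) := by
  have : discreteCost φ rp sp rm sm
      = fun p => ∑ i, ((designMatrix φ rp rm).mulVec p i - Sum.elim sp sm i) ^ 2 :=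
    funext (discreteCost_eq_designMatrix φ rp sp rm sm)
  rw [this]
  exact convexOn_sum_sq_mulVec_sub _ _

theorem discreteCost_leastSquaresSolution_lt {φ : Fin m → ℝ → ℝ} {rp : Fin N → ℝ}
    {rm : Fin M → ℝ} (hX : LinearIndependent ℝ (designMatrix φ rp rm).col) (sp : Fin N → ℝ)
    (sm : Fin M → ℝ) {q : Fin m → ℝ}
    (hq : q ≠ leastSquaresSolution (designMatrix φ rp rm) (Sum.elim sp sm)) :
    discreteCost φ rp sp rm sm (leastSquaresSolution (designMatrix φ rp rm) (Sum.elim sp sm))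
      < discreteCost φ rp sp rm sm q := by
  rw [discreteCost_eq_designMatrix, discreteCost_eq_designMatrix]
  exact sum_sq_leastSquaresSolution_lt hX _ hq

/-- Strict minimality of the closed form, written out for a model with two parameters. -/
theorem sum_sq_two_parameters_lt {φ : Fin 2 → ℝ → ℝ} {rp sp : Fin N → ℝ} {rm sm : Fin M → ℝ}
    {X : Matrix (Fin N ⊕ Fin M) (Fin 2) ℝ} (hXφ : X = designMatrix φ rp rm)
    (hX : LinearIndependent ℝ X.col) {a b a' b' : ℝ}
    (hab : ![a, b] = leastSquaresSolution X (Sum.elim sp sm)) (hne : ![a', b'] ≠ ![a, b]) :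
    (∑ i, (a * φ 0 (rp i) + b * φ 1 (rp i) - sp i) ^ 2)
        + ∑ i, (a * φ 0 (rm i) + b * φ 1 (rm i) - sm i) ^ 2
      < (∑ i, (a' * φ 0 (rp i) + b' * φ 1 (rp i) - sp i) ^ 2)
        + ∑ i, (a' * φ 0 (rm i) + b' * φ 1 (rm i) - sm i) ^ 2 := by
  subst hXφ
  rw [hab] at hne
  have h := discreteCost_leastSquaresSolution_lt hX sp sm hne
  rw [← hab] at h
  simpa only [discreteCost_eq_linModel, linModel, Fin.sum_univ_two, Matrix.cons_val_zero,
    Matrix.cons_val_one] using h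

theorem sampledDistSq_eq_discreteCost (φ : Fin m → ℝ → ℝ) (t : Fin N → ℝ) (p : Fin m → ℝ)
    {u v : Transform} (hp : u.posMass ≠ 0) (hn : u.negMass ≠ 0) :
    sampledDistSq t (comp (linModel φ p) u) v
      = discreteCost φ (u.pos ∘ t) (v.pos ∘ t) (u.neg ∘ t) (v.neg ∘ t) p := by
  simp only [sampledDistSq, comp, if_neg hp, if_neg hn, discreteCost_eq_linModel,
    Function.comp_apply]

open Polynomial in
/-- The columns `1, z, …, zⁿ` are dependent exactly if a nonzero polynomial of degree at most `n`
vanishes at all nodes; the nodal polynomial is one as soon as there are at most `n` nodes. -/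
theorem linearIndependent_col_monomials_iff (n : ℕ) (rp : Fin N → ℝ) (rm : Fin M → ℝ) :
    LinearIndependent ℝ (designMatrix (monomials n) rp rm).col ↔
      n + 1 ≤ (range rp ∪ range rm).ncard := by
  classical
  set z : Fin N ⊕ Fin M → ℝ := Sum.elim rp rm with hz
  set Z : Finset ℝ := Finset.univ.image z with hZ
  have hcard : (range rp ∪ range rm).ncard = Z.card := by
    rw [← Set.Sum.elim_range, ← Set.ncard_coe_finset, hZ, Finset.coe_image, Finset.coe_univ,
      image_univ]
  have hmul : ∀ p i, (designMatrix (monomials n) rp rm).mulVec p i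
      = linModel (monomials n) p (z i) := by
    rintro p (i | i) <;>
    simp [designMatrix, Matrix.fromRows_mulVec, modelMatrix_mulVec, hz]
  rw [hcard, ← Matrix.mulVec_injective_iff]
  constructor
  · intro hinj
    by_contra hlt
    set P : ℝ[X] := ∏ a ∈ Z, (X - C a) with hP
    have hmonic : P.Monic := monic_prod_of_monic _ _ fun a _ => monic_X_sub_C a
    have hdeg : P.natDegree = Z.card := by
      rw [hP, natDegree_prod_of_monic _ _ fun a _ => monic_X_sub_C a]
      simp
    have hev : ∀ x, linModel (monomials n) (fun k => P.coeff k) x = P.eval x := by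
      intro x
      rw [eval_eq_sum_range' (by omega : P.natDegree < n + 1), Finset.sum_range]
      rfl
    have h0 : (fun k : Fin (n + 1) => P.coeff k) = 0 := by
      refine hinj ?_
      rw [Matrix.mulVec_zero]
      funext i
      rw [hmul, hev, hP, eval_prod, Pi.zero_apply]
      exact Finset.prod_eq_zero (Finset.mem_image_of_mem z (Finset.mem_univ i)) (by simp)
    have hlead := congrFun h0 ⟨P.natDegree, by omega⟩
    simp only [coeff_natDegree, hmonic.leadingCoeff, Pi.zero_apply] at hlead
    exact one_ne_zero hlead
  · intro hle
    refine (injective_iff_map_eq_zero (designMatrix (monomials n) rp rm).mulVecLin).2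
      fun p hp => ?_
    have hP0 : (∑ k : Fin (n + 1), C (p k) * X ^ (k : ℕ) : ℝ[X]) = 0 := by
      refine eq_zero_of_degree_lt_of_eval_finset_eq_zero Z ?_ ?_
      · refine lt_of_lt_of_le (degree_sum_fin_lt p) ?_
        exact_mod_cast hle
      · intro x hx
        obtain ⟨i, -, rfl⟩ := Finset.mem_image.1 hx
        have h1 := congrFun hp i
        rw [Matrix.mulVecLin_apply, hmul, linModel_monomials_eq_eval] at h1
        exact h1
    funext k
    have := congrArg (fun Q : ℝ[X] => Q.coeff k) hP0
    simpa [finsetSum_coeff, coeff_C_mul, coeff_X_pow, Fin.val_inj] using this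

end Discrete

/-! ### Square-integrability in transform space -/

section SquareIntegrable

variable {s₀ r s u : ℝ → ℝ}

theorem isReference_aemeasurable (h : IsReference u) :
    AEMeasurable fun x => ENNReal.ofReal (u x) :=
  h.integrable.aemeasurable.ennreal_ofReal

/-- Second moments of `φ ∘ û` are second moments of `φ` with respect to the signal. -/
theorem memLp_comp_cdtOrZero (h₀ : IsReference s₀) (hu : ∀ x, 0 ≤ u x) (hui : Integrable u)
    {φ : ℝ → ℝ} (hφ : Measurable φ) (hφu : Integrable fun x => u x * φ x ^ 2)
    (hne : l1Norm u ≠ 0) : MemLp (φ ∘ cdtOrZero s₀ u) 2 (refMeasure s₀) := by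
  have hru := isReference_normalize hu hui hne
  have hT := cdtOrZero_aemeasurable h₀ hu hui
  rw [← memLp_map_measure_iff hφ.aestronglyMeasurable hT, map_cdtOrZero h₀ hu hui,
    normalizedMeasure, if_neg hne, memLp_two_iff_integrable_sq hφ.aestronglyMeasurable,
    integrable_withDensity_iff_integrable_smul₀' (isReference_aemeasurable hru)
      (.of_forall fun _ => ENNReal.ofReal_lt_top)]
  refine (hφu.div_const (l1Norm u)).congr (.of_forall fun x => ?_)
  have hx := ENNReal.toReal_ofReal (hru.nonneg x)
  simp only [hx, smul_eq_mul]
  rw [normalize]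
  ring

theorem memLp_cdtOrZero (h₀ : IsReference s₀) (hu : ∀ x, 0 ≤ u x) (hui : Integrable u)
    (h2 : Integrable fun x => u x * x ^ 2) : MemLp (cdtOrZero s₀ u) 2 (refMeasure s₀) := by
  by_cases hne : l1Norm u = 0
  · rw [cdtOrZero, if_pos hne]; exact MemLp.zero
  · exact memLp_comp_cdtOrZero (φ := fun x => x) h₀ hu hui measurable_id h2 hne

theorem integrable_positivePart_mul_sq {φ : ℝ → ℝ} (h : Integrable fun x => r x * φ x ^ 2) :
    Integrable fun x => positivePart r x * φ x ^ 2 := by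
  refine (integrable_positivePart h).congr (.of_forall fun x => ?_)
  simp only [positivePart]
  rw [max_mul_of_nonneg _ _ (sq_nonneg _), zero_mul]

theorem integrable_negativePart_mul_sq {φ : ℝ → ℝ} (h : Integrable fun x => r x * φ x ^ 2) :
    Integrable fun x => negativePart r x * φ x ^ 2 := by
  rw [negativePart_eq]
  refine integrable_positivePart_mul_sq (h.neg.congr (.of_forall fun x => ?_))
  simp

theorem memLp_scdt_pos (h₀ : IsReference s₀) (hs : Integrable s)
    (h2 : Integrable fun x => s x * x ^ 2) : MemLp (scdt s₀ s).pos 2 (refMeasure s₀) :=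
  memLp_cdtOrZero h₀ (positivePart_nonneg s) (integrable_positivePart hs)
    (integrable_positivePart_mul_sq h2)

theorem memLp_scdt_neg (h₀ : IsReference s₀) (hs : Integrable s)
    (h2 : Integrable fun x => s x * x ^ 2) : MemLp (scdt s₀ s).neg 2 (refMeasure s₀) :=
  memLp_cdtOrZero h₀ (negativePart_nonneg s) (integrable_negativePart hs)
    (integrable_negativePart_mul_sq h2)

theorem memLp_comp_scdt_pos (h₀ : IsReference s₀) (hr : Integrable r) {φ : ℝ → ℝ}
    (hφ : Measurable φ) (h2 : Integrable fun x => r x * φ x ^ 2) :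
    MemLp (comp φ (scdt s₀ r)).pos 2 (refMeasure s₀) := by
  by_cases hne : (scdt s₀ r).posMass = 0
  · simp only [comp, if_pos hne]; exact MemLp.zero
  · simp only [comp, if_neg hne]
    exact memLp_comp_cdtOrZero h₀ (positivePart_nonneg r) (integrable_positivePart hr) hφ
      (integrable_positivePart_mul_sq h2) hne

theorem memLp_comp_scdt_neg (h₀ : IsReference s₀) (hr : Integrable r) {φ : ℝ → ℝ}
    (hφ : Measurable φ) (h2 : Integrable fun x => r x * φ x ^ 2) :
    MemLp (comp φ (scdt s₀ r)).neg 2 (refMeasure s₀) := by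
  by_cases hne : (scdt s₀ r).negMass = 0
  · simp only [comp, if_pos hne]; exact MemLp.zero
  · simp only [comp, if_neg hne]
    exact memLp_comp_cdtOrZero h₀ (negativePart_nonneg r) (integrable_negativePart hr) hφ
      (integrable_negativePart_mul_sq h2) hne

theorem distS_lt_top (h₀ : IsReference s₀) (hr : Integrable r) (hs : Integrable s)
    (hr2 : Integrable fun x => r x * x ^ 2) (hs2 : Integrable fun x => s x * x ^ 2) :
    distS r s < ⊤ := by
  rw [distS_eq_transformDist h₀ hr hs, transformDist, shapeDistSq]
  refine ENNReal.rpow_lt_top_of_nonneg (by norm_num) (ENNReal.add_ne_top.2 ⟨?_, by simp⟩)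
  exact ENNReal.add_ne_top.2
    ⟨ENNReal.pow_ne_top ((memLp_scdt_pos h₀ hr hr2).sub (memLp_scdt_pos h₀ hs hs2)).2.ne,
      ENNReal.pow_ne_top ((memLp_scdt_neg h₀ hr hr2).sub (memLp_scdt_neg h₀ hs hs2)).2.ne⟩

/-! ### The least-squares problem in transform space -/

section LeastSquares

variable {m : ℕ} {φ : Fin m → ℝ → ℝ}

theorem comp_linModel_pos (φ : Fin m → ℝ → ℝ) (p : Fin m → ℝ) (U : Transform) :
    (comp (linModel φ p) U).pos = fun x => ∑ k, p k * (comp (φ k) U).pos x := by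
  funext x
  by_cases h : U.posMass = 0 <;> simp [comp, h, linModel]

theorem comp_linModel_neg (φ : Fin m → ℝ → ℝ) (p : Fin m → ℝ) (U : Transform) :
    (comp (linModel φ p) U).neg = fun x => ∑ k, p k * (comp (φ k) U).neg x := by
  funext x
  by_cases h : U.negMass = 0 <;> simp [comp, h, linModel]

section Integrals

variable {μ : Measure ℝ} {a : Fin m → ℝ → ℝ} {y : ℝ → ℝ}

theorem memLp_sum_mul (ha : ∀ k, MemLp (a k) 2 μ) (p : Fin m → ℝ) :
    MemLp (fun x => ∑ k, p k * a k x) 2 μ :=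
  memLp_finsetSum _ fun k _ => (ha k).const_mul (p k)

/-- Expansion of the squared `L²` distance from a linear combination. -/
theorem integral_sq_sum_sub (ha : ∀ k, MemLp (a k) 2 μ) (hy : MemLp y 2 μ) (p : Fin m → ℝ) :
    ∫ x, (∑ k, p k * a k x - y x) ^ 2 ∂μ
      = p ⬝ᵥ (Matrix.of fun k l => ∫ x, a k x * a l x ∂μ).mulVec p
        - 2 * (p ⬝ᵥ fun k => ∫ x, a k x * y x ∂μ) + ∫ x, y x ^ 2 ∂μ := by
  have haa : ∀ k l, Integrable (fun x => a k x * a l x) μ := fun k l =>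
    (ha k).integrable_mul (ha l)
  have hay : ∀ k, Integrable (fun x => a k x * y x) μ := fun k => (ha k).integrable_mul hy
  have hexp : ∀ x, (∑ k, p k * a k x - y x) ^ 2
      = (∑ k, ∑ l, p k * p l * (a k x * a l x)) - 2 * (∑ k, p k * (a k x * y x)) + y x ^ 2 := by
    intro x
    have h1 : (∑ k, p k * a k x) * y x = ∑ k, p k * (a k x * y x) := by
      rw [Finset.sum_mul]; exact Finset.sum_congr rfl fun k _ => by ring
    have h2 : (∑ k, p k * a k x) * (∑ l, p l * a l x)
        = ∑ k, ∑ l, p k * p l * (a k x * a l x) := by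
      rw [Finset.sum_mul_sum]
      exact Finset.sum_congr rfl fun k _ => Finset.sum_congr rfl fun l _ => by ring
    rw [← h1, ← h2]; ring
  have hi1 : Integrable (fun x => ∑ k, ∑ l, p k * p l * (a k x * a l x)) μ :=
    integrable_finsetSum _ fun k _ => integrable_finsetSum _ fun l _ => (haa k l).const_mul _
  have hi2 : Integrable (fun x => ∑ k, p k * (a k x * y x)) μ :=
    integrable_finsetSum _ fun k _ => (hay k).const_mul _
  simp only [hexp]
  have hi12 : Integrable (fun x => (∑ k, ∑ l, p k * p l * (a k x * a l x))
      - 2 * ∑ k, p k * (a k x * y x)) μ := hi1.sub (hi2.const_mul 2)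
  rw [integral_add hi12 hy.integrable_sq,
    integral_sub hi1 (hi2.const_mul 2), integral_const_mul,
    integral_finsetSum _ fun k _ => (hay k).const_mul _,
    integral_finsetSum _ fun k _ => integrable_finsetSum _ fun l _ => (haa k l).const_mul _]
  have e1 : ∑ k, ∫ x, ∑ l, p k * p l * (a k x * a l x) ∂μ
      = p ⬝ᵥ (Matrix.of fun k l => ∫ x, a k x * a l x ∂μ).mulVec p := by
    refine Finset.sum_congr rfl fun k _ => ?_
    rw [integral_finsetSum _ fun l _ => (haa k l).const_mul _]
    simp only [Matrix.mulVec, dotProduct, Matrix.of_apply, Finset.mul_sum, integral_const_mul]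
    exact Finset.sum_congr rfl fun l _ => by ring
  have e2 : ∑ k, ∫ x, p k * (a k x * y x) ∂μ = p ⬝ᵥ fun k => ∫ x, a k x * y x ∂μ := by
    simp only [dotProduct, integral_const_mul]
  rw [e1, e2]

theorem dotProduct_mulVec_integral (ha : ∀ k, MemLp (a k) 2 μ) (p : Fin m → ℝ) :
    p ⬝ᵥ (Matrix.of fun k l => ∫ x, a k x * a l x ∂μ).mulVec p
      = ∫ x, (∑ k, p k * a k x) ^ 2 ∂μ := by
  have h := integral_sq_sum_sub ha (MemLp.zero (p := 2) (μ := μ)) p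
  simp only [Pi.zero_apply, sub_zero, mul_zero, integral_zero] at h
  rw [h]
  simp [dotProduct]

theorem ofReal_integral_sq {f : ℝ → ℝ} (hf : MemLp f 2 μ) :
    eLpNorm f 2 μ ^ 2 = ENNReal.ofReal (∫ x, f x ^ 2 ∂μ) := by
  rw [eLpNorm_two_sq, ofReal_integral_eq_lintegral_ofReal hf.integrable_sq
    (.of_forall fun x => sq_nonneg _)]

end Integrals

theorem gram_eq_add : gram s₀ r φ
    = (Matrix.of fun k l => ∫ x, (comp (φ k) (scdt s₀ r)).pos x
        * (comp (φ l) (scdt s₀ r)).pos x ∂refMeasure s₀)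
      + Matrix.of fun k l => ∫ x, (comp (φ k) (scdt s₀ r)).neg x
        * (comp (φ l) (scdt s₀ r)).neg x ∂refMeasure s₀ := rfl

theorem gramRhs_eq_add : gramRhs s₀ r s φ
    = (fun k => ∫ x, (comp (φ k) (scdt s₀ r)).pos x * (scdt s₀ s).pos x ∂refMeasure s₀)
      + fun k => ∫ x, (comp (φ k) (scdt s₀ r)).neg x * (scdt s₀ s).neg x ∂refMeasure s₀ := rfl

theorem isSymm_gram : (gram s₀ r φ).IsSymm := by
  ext k l
  simp only [gram, Matrix.transpose_apply, Matrix.of_apply, mul_comm]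

theorem fitCost_eq_quadratic (h₀ : IsReference s₀) (hr : Integrable r) (hs : Integrable s)
    (hφ : ∀ k, Measurable (φ k)) (hφr : ∀ k, Integrable fun x => r x * φ k x ^ 2)
    (hs2 : Integrable fun x => s x * x ^ 2) (p : Fin m → ℝ) :
    fitCost s₀ r s φ p
      = p ⬝ᵥ (gram s₀ r φ).mulVec p - 2 * (p ⬝ᵥ gramRhs s₀ r s φ) + fitCost s₀ r s φ 0 := by
  have hP := integral_sq_sum_sub (fun k => memLp_comp_scdt_pos h₀ hr (hφ k) (hφr k))
    (memLp_scdt_pos h₀ hs hs2)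
  have hN := integral_sq_sum_sub (fun k => memLp_comp_scdt_neg h₀ hr (hφ k) (hφr k))
    (memLp_scdt_neg h₀ hs hs2)
  simp only [fitCost, comp_linModel_pos, comp_linModel_neg]
  rw [hP p, hN p, hP 0, hN 0, gram_eq_add, gramRhs_eq_add, Matrix.add_mulVec, dotProduct_add,
    dotProduct_add]
  simp only [zero_dotProduct]
  ring

theorem dotProduct_gram_eq (h₀ : IsReference s₀) (hr : Integrable r)
    (hφ : ∀ k, Measurable (φ k)) (hφr : ∀ k, Integrable fun x => r x * φ k x ^ 2)
    (p : Fin m → ℝ) :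
    p ⬝ᵥ (gram s₀ r φ).mulVec p
      = (∫ x, (∑ k, p k * (comp (φ k) (scdt s₀ r)).pos x) ^ 2 ∂refMeasure s₀)
        + ∫ x, (∑ k, p k * (comp (φ k) (scdt s₀ r)).neg x) ^ 2 ∂refMeasure s₀ := by
  rw [gram_eq_add, Matrix.add_mulVec, dotProduct_add,
    dotProduct_mulVec_integral fun k => memLp_comp_scdt_pos h₀ hr (hφ k) (hφr k),
    dotProduct_mulVec_integral fun k => memLp_comp_scdt_neg h₀ hr (hφ k) (hφr k)]

theorem convexOn_fitCost (h₀ : IsReference s₀) (hr : Integrable r) (hs : Integrable s)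
    (hφ : ∀ k, Measurable (φ k)) (hφr : ∀ k, Integrable fun x => r x * φ k x ^ 2)
    (hs2 : Integrable fun x => s x * x ^ 2) : ConvexOn ℝ univ (fitCost s₀ r s φ) := by
  refine convexOn_of_quadratic isSymm_gram (fun p => ?_)
    (fitCost_eq_quadratic h₀ hr hs hφ hφr hs2)
  rw [dotProduct_gram_eq h₀ hr hφ hφr]
  exact add_nonneg (integral_nonneg fun _ => sq_nonneg _) (integral_nonneg fun _ => sq_nonneg _)

/-- Independence of the columns makes the Gram matrix positive definite. -/
theorem dotProduct_gram_pos (h₀ : IsReference s₀) (hr : Integrable r)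
    (hφ : ∀ k, Measurable (φ k)) (hφr : ∀ k, Integrable fun x => r x * φ k x ^ 2)
    (hind : IndependentColumns s₀ r φ) (p : Fin m → ℝ) (hp : p ≠ 0) :
    0 < p ⬝ᵥ (gram s₀ r φ).mulVec p := by
  rw [dotProduct_gram_eq h₀ hr hφ hφr]
  have hP := memLp_sum_mul (fun k => memLp_comp_scdt_pos h₀ hr (hφ k) (hφr k)) p
  have hN := memLp_sum_mul (fun k => memLp_comp_scdt_neg h₀ hr (hφ k) (hφr k)) p
  have hP0 : 0 ≤ ∫ x, (∑ k, p k * (comp (φ k) (scdt s₀ r)).pos x) ^ 2 ∂refMeasure s₀ :=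
    integral_nonneg fun _ => sq_nonneg _
  have hN0 : 0 ≤ ∫ x, (∑ k, p k * (comp (φ k) (scdt s₀ r)).neg x) ^ 2 ∂refMeasure s₀ :=
    integral_nonneg fun _ => sq_nonneg _
  refine lt_of_le_of_ne (add_nonneg hP0 hN0) fun h => hp ?_
  obtain ⟨h1, h2⟩ := (add_eq_zero_iff_of_nonneg hP0 hN0).1 h.symm
  rw [integral_eq_zero_iff_of_nonneg (fun _ => sq_nonneg _) hP.integrable_sq] at h1
  rw [integral_eq_zero_iff_of_nonneg (fun _ => sq_nonneg _) hN.integrable_sq] at h2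
  exact hind p (h1.mono fun x hx => pow_eq_zero_iff two_ne_zero |>.1 hx)
    (h2.mono fun x hx => pow_eq_zero_iff two_ne_zero |>.1 hx)

theorem distS_sq_linModel (h₀ : IsReference s₀) (hr : Integrable r) (hs : Integrable s)
    (hφ : ∀ k, Measurable (φ k)) (hφr : ∀ k, Integrable fun x => r x * φ k x ^ 2)
    (hs2 : Integrable fun x => s x * x ^ 2) {I : Set ℝ} {p : Fin m → ℝ}
    (h : IsWarp I (linModel φ p)) (hI : ∀ᵐ x, x ∉ I → r x = 0) :
    distS (warpedSignal I (linModel φ p) r) s ^ 2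
      = ENNReal.ofReal (fitCost s₀ r s φ p + massGap r s) := by
  have hP := (memLp_sum_mul (fun k => memLp_comp_scdt_pos h₀ hr (hφ k) (hφr k)) p).sub
    (memLp_scdt_pos h₀ hs hs2)
  have hN := (memLp_sum_mul (fun k => memLp_comp_scdt_neg h₀ hr (hφ k) (hφr k)) p).sub
    (memLp_scdt_neg h₀ hs hs2)
  have hgap : 0 ≤ massGap r s := add_nonneg (sq_nonneg _) (sq_nonneg _)
  have hP0 : 0 ≤ ∫ x, ((comp (linModel φ p) (scdt s₀ r)).pos x - (scdt s₀ s).pos x) ^ 2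
      ∂refMeasure s₀ := integral_nonneg fun _ => sq_nonneg _
  have hN0 : 0 ≤ ∫ x, ((comp (linModel φ p) (scdt s₀ r)).neg x - (scdt s₀ s).neg x) ^ 2
      ∂refMeasure s₀ := integral_nonneg fun _ => sq_nonneg _
  rw [← comp_linModel_pos] at hP
  rw [← comp_linModel_neg] at hN
  rw [distS_sq_warpedSignal h₀ h hr hI hs, shapeDistSq, ofReal_integral_sq hP,
    ofReal_integral_sq hN, fitCost, ENNReal.ofReal_add (add_nonneg hP0 hN0) hgap,
    ENNReal.ofReal_add hP0 hN0]
  rfl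

theorem distS_linModel_lt (h₀ : IsReference s₀) (hr : Integrable r) (hs : Integrable s)
    (hφ : ∀ k, Measurable (φ k)) (hφr : ∀ k, Integrable fun x => r x * φ k x ^ 2)
    (hs2 : Integrable fun x => s x * x ^ 2) {I : Set ℝ} {p q : Fin m → ℝ}
    (hp : IsWarp I (linModel φ p)) (hq : IsWarp I (linModel φ q))
    (hI : ∀ᵐ x, x ∉ I → r x = 0) (hlt : fitCost s₀ r s φ p < fitCost s₀ r s φ q) :
    distS (warpedSignal I (linModel φ p) r) s < distS (warpedSignal I (linModel φ q) r) s := by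
  refine lt_of_pow_lt_pow_left' 2 ?_
  rw [distS_sq_linModel h₀ hr hs hφ hφr hs2 hp hI, distS_sq_linModel h₀ hr hs hφ hφr hs2 hq hI]
  have hgap : 0 ≤ massGap r s := add_nonneg (sq_nonneg _) (sq_nonneg _)
  have hC : 0 ≤ fitCost s₀ r s φ p :=
    add_nonneg (integral_nonneg fun _ => sq_nonneg _) (integral_nonneg fun _ => sq_nonneg _)
  exact (ENNReal.ofReal_lt_ofReal_iff (by linarith)).2 (by linarith)

end LeastSquares

theorem distS_sq_warpedSignal_of_mass_ne_zero (h₀ : IsReference s₀) {I : Set ℝ} {g : ℝ → ℝ}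
    (h : IsWarp I g) (hr : Integrable r) (hI : ∀ᵐ x, x ∉ I → r x = 0) (hs : Integrable s)
    (hp : (scdt s₀ r).posMass ≠ 0) (hn : (scdt s₀ r).negMass ≠ 0) :
    distS (warpedSignal I g r) s ^ 2
      = eLpNorm (fun x => g ((scdt s₀ r).pos x) - (scdt s₀ s).pos x) 2 (refMeasure s₀) ^ 2
        + eLpNorm (fun x => g ((scdt s₀ r).neg x) - (scdt s₀ s).neg x) 2 (refMeasure s₀) ^ 2
        + ENNReal.ofReal (massGap r s) := by
  rw [distS_sq_warpedSignal h₀ h hr hI hs, shapeDistSq]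
  simp only [comp, if_neg hp, if_neg hn]
  rfl

end SquareIntegrable

end SignalSCDT

open SignalSCDT in
theorem mainTheorem1 (s₀ r s : ℝ → ℝ) (h₀ : IsReference s₀)
    (hr : Integrable r) (hs : Integrable s) :
    -- the distance in transform space
    (∀ (I : Set ℝ) (g : ℝ → ℝ), IsWarp I g → (∀ᵐ x, x ∉ I → r x = 0) →
      Integrable (warpedSignal I g r) ∧
      (scdt s₀ (warpedSignal I g r)).pos =ᵐ[refMeasure s₀] (comp g (scdt s₀ r)).pos ∧
      (scdt s₀ (warpedSignal I g r)).neg =ᵐ[refMeasure s₀] (comp g (scdt s₀ r)).neg ∧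
      (scdt s₀ (warpedSignal I g r)).posMass = (scdt s₀ r).posMass ∧
      (scdt s₀ (warpedSignal I g r)).negMass = (scdt s₀ r).negMass ∧
      distS (warpedSignal I g r) s
        = transformDist s₀ (scdt s₀ (warpedSignal I g r)) (scdt s₀ s) ∧
      distS (warpedSignal I g r) s = transformDist s₀ (comp g (scdt s₀ r)) (scdt s₀ s) ∧
      wassersteinFunctional (warpedSignal I g r) s
        = shapeDistSq s₀ (comp g (scdt s₀ r)) (scdt s₀ s) ∧
      (Integrable (fun x => warpedSignal I g r x * x ^ 2) → Integrable (fun x => s x * x ^ 2) →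
        distS (warpedSignal I g r) s < ⊤)) ∧
    -- increasing polynomials are admissible
    (∀ (I : Set ℝ) (n : ℕ) (p : Fin (n + 1) → ℝ), I.OrdConnected →
      StrictMonoOn (linModel (monomials n) p) I → IsWarp I (linModel (monomials n) p)) ∧
    -- models linear in the parameters: the least-squares problem in transform space
    (∀ (m : ℕ) (φ : Fin m → ℝ → ℝ), (∀ k, Measurable (φ k)) →
      (∀ k, Integrable (fun x => r x * φ k x ^ 2)) → Integrable (fun x => s x * x ^ 2) →
      (∀ (I : Set ℝ) (p : Fin m → ℝ), IsWarp I (linModel φ p) → (∀ᵐ x, x ∉ I → r x = 0) →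
        distS (warpedSignal I (linModel φ p) r) s ^ 2
          = ENNReal.ofReal (fitCost s₀ r s φ p + massGap r s)) ∧
      (∀ p, fitCost s₀ r s φ p
        = p ⬝ᵥ (gram s₀ r φ).mulVec p - 2 * (p ⬝ᵥ gramRhs s₀ r s φ) + fitCost s₀ r s φ 0) ∧
      ConvexOn ℝ univ (fitCost s₀ r s φ) ∧
      (IndependentColumns s₀ r φ →
        IsUnit (gram s₀ r φ).det ∧
        (∀ q, q ≠ (gram s₀ r φ)⁻¹.mulVec (gramRhs s₀ r s φ) →
          fitCost s₀ r s φ ((gram s₀ r φ)⁻¹.mulVec (gramRhs s₀ r s φ)) < fitCost s₀ r s φ q) ∧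
        (∀ (I : Set ℝ) (p q : Fin m → ℝ), (∀ᵐ x, x ∉ I → r x = 0) →
          p = (gram s₀ r φ)⁻¹.mulVec (gramRhs s₀ r s φ) → q ≠ p →
          IsWarp I (linModel φ p) → IsWarp I (linModel φ q) →
          distS (warpedSignal I (linModel φ p) r) s
            < distS (warpedSignal I (linModel φ q) r) s))) ∧
    -- the discrete least-squares problem and its closed-form solution
    (∀ (m N M : ℕ) (φ : Fin m → ℝ → ℝ) (rp sp : Fin N → ℝ) (rm sm : Fin M → ℝ),
      (∀ p, discreteCost φ rp sp rm sm p
        = (∑ i, (linModel φ p (rp i) - sp i) ^ 2) + ∑ i, (linModel φ p (rm i) - sm i) ^ 2) ∧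
      (∀ p, discreteCost φ rp sp rm sm p
        = ∑ i, ((designMatrix φ rp rm).mulVec p i - Sum.elim sp sm i) ^ 2) ∧
      ConvexOn ℝ univ (discreteCost φ rp sp rm sm) ∧
      (LinearIndependent ℝ (designMatrix φ rp rm).col →
        IsUnit ((designMatrix φ rp rm).transpose * designMatrix φ rp rm).det ∧
        ∀ q, q ≠ leastSquaresSolution (designMatrix φ rp rm) (Sum.elim sp sm) →
          discreteCost φ rp sp rm sm
            (leastSquaresSolution (designMatrix φ rp rm) (Sum.elim sp sm))
            < discreteCost φ rp sp rm sm q)) ∧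
    -- it is the discretization of the problem in transform space
    (∀ (m N : ℕ) (φ : Fin m → ℝ → ℝ) (t : Fin N → ℝ) (p : Fin m → ℝ),
      (scdt s₀ r).posMass ≠ 0 → (scdt s₀ r).negMass ≠ 0 →
      sampledDistSq t (comp (linModel φ p) (scdt s₀ r)) (scdt s₀ s)
        = discreteCost φ ((scdt s₀ r).pos ∘ t) ((scdt s₀ s).pos ∘ t)
            ((scdt s₀ r).neg ∘ t) ((scdt s₀ s).neg ∘ t) p) ∧
    -- polynomials: when the columns are linearly independent
    (∀ (n N M : ℕ) (rp : Fin N → ℝ) (rm : Fin M → ℝ),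
      LinearIndependent ℝ (designMatrix (monomials n) rp rm).col ↔
        n + 1 ≤ (range rp ∪ range rm).ncard) ∧
    -- the linear case `g(t) = ω t + τ`
    ((∀ ω τ : ℝ, 0 < ω → (scdt s₀ r).posMass ≠ 0 → (scdt s₀ r).negMass ≠ 0 →
        distS (warpedSignal univ (fun t => ω * t + τ) r) s ^ 2
          = eLpNorm (fun x => ω * (scdt s₀ r).pos x + τ - (scdt s₀ s).pos x) 2
                (refMeasure s₀) ^ 2
            + eLpNorm (fun x => ω * (scdt s₀ r).neg x + τ - (scdt s₀ s).neg x) 2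
                (refMeasure s₀) ^ 2
            + ENNReal.ofReal (massGap r s)) ∧
      (∀ (N M : ℕ) (rp sp : Fin N → ℝ) (rm sm : Fin M → ℝ) (X : Matrix (Fin N ⊕ Fin M) (Fin 2) ℝ),
        X = Matrix.of (Sum.elim (fun i => ![rp i, 1]) (fun i => ![rm i, 1])) →
        LinearIndependent ℝ X.col →
        ∀ ω τ : ℝ, ![ω, τ] = leastSquaresSolution X (Sum.elim sp sm) →
        ∀ ω' τ' : ℝ, ![ω', τ'] ≠ ![ω, τ] →
          (∑ i, (ω * rp i + τ - sp i) ^ 2) + ∑ i, (ω * rm i + τ - sm i) ^ 2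
            < (∑ i, (ω' * rp i + τ' - sp i) ^ 2) + ∑ i, (ω' * rm i + τ' - sm i) ^ 2)) ∧
    -- the quadratic case `g(t) = κ t² + τ`, for signals on the half-line where `g` increases
    ((∀ κ τ : ℝ, 0 < κ → (∀ᵐ x, x ∉ Ici (0 : ℝ) → r x = 0) →
        (scdt s₀ r).posMass ≠ 0 → (scdt s₀ r).negMass ≠ 0 →
        distS (warpedSignal (Ici 0) (fun t => κ * t ^ 2 + τ) r) s ^ 2
          = eLpNorm (fun x => κ * (scdt s₀ r).pos x ^ 2 + τ - (scdt s₀ s).pos x) 2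
                (refMeasure s₀) ^ 2
            + eLpNorm (fun x => κ * (scdt s₀ r).neg x ^ 2 + τ - (scdt s₀ s).neg x) 2
                (refMeasure s₀) ^ 2
            + ENNReal.ofReal (massGap r s)) ∧
      (∀ (N M : ℕ) (rp sp : Fin N → ℝ) (rm sm : Fin M → ℝ) (X : Matrix (Fin N ⊕ Fin M) (Fin 2) ℝ),
        X = Matrix.of (Sum.elim (fun i => ![rp i ^ 2, 1]) (fun i => ![rm i ^ 2, 1])) →
        LinearIndependent ℝ X.col →
        ∀ κ τ : ℝ, ![κ, τ] = leastSquaresSolution X (Sum.elim sp sm) →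
        ∀ κ' τ' : ℝ, ![κ', τ'] ≠ ![κ, τ] →
          (∑ i, (κ * rp i ^ 2 + τ - sp i) ^ 2) + ∑ i, (κ * rm i ^ 2 + τ - sm i) ^ 2
            < (∑ i, (κ' * rp i ^ 2 + τ' - sp i) ^ 2)
              + ∑ i, (κ' * rm i ^ 2 + τ' - sm i) ^ 2)) := by
  refine ⟨fun I g hg hI => ?_, fun I n p hI hp => isWarp_linModel_monomials hI hp,
    fun m φ hφ hφr hs2 => ?_, fun m N M φ rp sp rm sm => ?_,
    fun m N φ t p hp hn => sampledDistSq_eq_discreteCost φ t p hp hn,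
    fun n N M rp rm => linearIndependent_col_monomials_iff n rp rm, ⟨?_, ?_⟩, ⟨?_, ?_⟩⟩
  · have hrf := hg.integrable_warpedSignal hr
    exact ⟨hrf, scdt_warpedSignal_pos h₀ hg hr hI, scdt_warpedSignal_neg h₀ hg hr hI,
      scdt_warpedSignal_posMass hg hr hI, scdt_warpedSignal_negMass hg hr hI,
      distS_eq_transformDist h₀ hrf hs, distS_warpedSignal_eq_transformDist_comp h₀ hg hr hI hs,
      wassersteinFunctional_warpedSignal h₀ hg hr hI hs,
      fun h2 hs2 => distS_lt_top h₀ hrf hs h2 hs2⟩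
  · refine ⟨fun I p hp hI => distS_sq_linModel h₀ hr hs hφ hφr hs2 hp hI,
      fitCost_eq_quadratic h₀ hr hs hφ hφr hs2, convexOn_fitCost h₀ hr hs hφ hφr hs2,
      fun hind => ?_⟩
    have hpos := dotProduct_gram_pos h₀ hr hφ hφr hind
    have hmin : ∀ q, q ≠ (gram s₀ r φ)⁻¹.mulVec (gramRhs s₀ r s φ) →
        fitCost s₀ r s φ ((gram s₀ r φ)⁻¹.mulVec (gramRhs s₀ r s φ)) < fitCost s₀ r s φ q :=
      fun q hq => lt_of_quadratic_pos isSymm_gram hpos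
        (fitCost_eq_quadratic h₀ hr hs hφ hφr hs2) hq
    refine ⟨isUnit_det_of_quadratic_pos hpos, hmin, ?_⟩
    rintro I p q hI rfl hqp hp hq
    exact distS_linModel_lt h₀ hr hs hφ hφr hs2 hp hq hI (hmin q hqp)
  · exact ⟨discreteCost_eq_linModel φ rp sp rm sm, discreteCost_eq_designMatrix φ rp sp rm sm,
      convexOn_discreteCost φ rp sp rm sm, fun hX => ⟨isUnit_det_transpose_mul hX,
        fun q hq => discreteCost_leastSquaresSolution_lt hX sp sm hq⟩⟩
  · intro ω τ hω hp hn
    exact distS_sq_warpedSignal_of_mass_ne_zero h₀ (isWarp_affine hω τ) hr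
      (.of_forall fun x hx => absurd (mem_univ x) hx) hs hp hn
  · intro N M rp sp rm sm X hX hind ω τ h ω' τ' hne
    have hXφ : X = designMatrix linearBasis rp rm := by
      rw [hX]
      ext (i | i) j <;> fin_cases j <;> rfl
    simpa [linearBasis] using sum_sq_two_parameters_lt hXφ hind h hne
  · intro κ τ hκ hI hp hn
    exact distS_sq_warpedSignal_of_mass_ne_zero h₀ (isWarp_quadratic hκ τ) hr hI hs hp hn
  · intro N M rp sp rm sm X hX hind κ τ h κ' τ' hne
    have hXφ : X = designMatrix quadraticBasis rp rm := by
      rw [hX]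
      ext (i | i) j <;> fin_cases j <;> rfl
    simpa [quadraticBasis] using sum_sq_two_parameters_lt hXφ hind h hne
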